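/- Let $d\in\{2,3\}$, let $k\ge q\ge 0$ be integers and let $\rho>0$. **Meshes.** Let $\Omega\subset\mathbb R^d$ be a bounded polygonal/polyhedral domain and let $\mathcal T_h$ be a finite partition of $\Omega$ into closed polytopes $T$, convex or not, with set $\mathcal E_h$ of edges ($d=2$) or flat faces ($d=3$). The boundary $\partial T$ of each element is a union of non-overlapping faces $e\in\mathcal E_h$, $\mathbf n$ is its unit outward normal, $N=N_T$ is the number of faces of $T$, $h_T$ and $h_e$ are the diameters of $T$ and $e$, and $h=\max_T h_T$. The mesh is called *shape regular* with constants $\rho_v,\rho_e,\kappa,\sigma_*,\gamma_*,\rho_s,\delta>0$, $\theta_0<\pi/2$ and $m,N_0\in\mathbb N$ if 1. $\rho_v h_T^d\le |T|$ and $\rho_e h_e^{d-1}\le|e|$ for all $T\in\mathcal T_h$ and $e\in\mathcal E_h$; 2. $\kappa h_T\le h_e$ for every face $e$ of $T$; 3. for every face $e$ of $T$ there is $A_e\in T$ such that the pyramid with base $e$ and apex $A_e$ is contained in $T$, has height at least $\sigma_*h_T$, and, for every $x\in e$, the angle between $x-A_e$ and the outward normal of $e$ is at most $\theta_0$; 4.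 each $T$ is contained in a simplex $S(T)$ with $|S(T)|\ge\rho_s h_{S(T)}^d$ and $h_{S(T)}\le\gamma_*h_T$, where $h_{S(T)}$ is the diameter of $S(T)$, and each $S(T)$ meets $S(T')$ for at most $m$ elements $T'$; 5. each $T$ has at most $N_0$ faces; 6. for any two distinct faces $e,e'$ of $T$, some point of $e$ has distance at least $\delta h_T$ to the hyperplane spanned by $e'$. **Coefficients.** Let $\mathbf b\in[W^{1,\infty}(\Omega)]^d$ (with its representative continuous on $\overline\Omega$) and $c\in L^1(\Omega)$ satisfy $c+\frac12\nabla\cdot\mathbf b\ge c_0$ a.e. in $\Omega$ for a constant $c_0>0$. Let $\partial T^{\pm}$ denote the part of $\partial T$ where $\pm\,\mathbf b\cdot\mathbf n>0$. **Discrete spaces and weak gradient.** $V_h$ is the space of pairs $v=\{v_0,v_b\}$ with $v_0|_T\in P_k(T)$ for all $T\in\mathcal T_h$ and $v_b|_e\in P_q(e)$, single-valued, for all $e\in\mathcal E_h$. On $T$ put $r=k-1+N$ if $T$ is convex and $r=k-1+2N$ otherwise. The discrete weak gradient $\nabla_wv|_T\in[P_r(T)]^d$ is the unique solution of $$(\nabla_w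 v,\boldsymbol\varphi)_T=-(v_0,\nabla\cdot\boldsymbol\varphi)_T+\langle v_b,\boldsymbol\varphi\cdot\mathbf n\rangle_{\partial T}\qquad\forall\,\boldsymbol\varphi\in[P_r(T)]^d .$$ **Norms.** For $v\in V_h$ let $$B_T(v)=\tfrac12\langle \mathbf b\cdot\mathbf n(v_b-v_0),v_0-v_b\rangle_{\partial T^-}+\tfrac12\langle \mathbf b\cdot\mathbf n(v_0-v_b),v_0-v_b\rangle_{\partial T^+}+\big((c+\tfrac12\nabla\cdot\mathbf b)v_0,v_0\big)_T,$$ $$|||v|||^2=\sum_{T\in\mathcal T_h}\Big(\rho\|\nabla_wv\|_T^2+B_T(v)\Big),\qquad \|v\|_{1,h}^2=\sum_{T\in\mathcal T_h}\Big(\rho\|\nabla v_0\|_T^2+B_T(v)+h_T^{-1}\|v_0-v_b\|_{\partial T}^2\Big).$$ **Claim.** There are constants $C_1,C_2>0$, depending only on $d,k,q,\rho$ and the constants in the shape-regularity conditions (in particular not on $h$), such that for every such $\Omega$, $\mathbf b$, $c$, every shape-regular mesh $\mathcal T_h$ of $\Omega$ with the given constants and every $v\in V_h$, $$C_1\|v\|_{1,h}\le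 |||v|||\le C_2\|v\|_{1,h}.$$ -/

import Mathlib

open MeasureTheory Topology Filter

open scoped MeasureTheory Classical

noncomputable section

namespace WG

/-- Euclidean space `ℝ^d`. -/
abbrev E (d : ℕ) := EuclideanSpace ℝ (Fin d)

/-- Real polynomials in `d` variables. -/
abbrev Poly (d : ℕ) := MvPolynomial (Fin d) ℝ

/-- The value of a polynomial at a point. -/
def pev {d : ℕ} (p : Poly d) (x : E d) : ℝ := MvPolynomial.eval (fun i => x i) p

/-! ### Polytopes, polytopal domains and meshes -/

/-- `A` is contained in a finite union of affine hyperplanes `{x | ⟪a, x⟫ = s}`, `a ≠ 0`. -/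
def InFinitelyManyHyperplanes {d : ℕ} (A : Set (E d)) : Prop :=
  ∃ H : Finset (E d × ℝ), (∀ p ∈ H, p.1 ≠ 0) ∧ ∀ x ∈ A, ∃ p ∈ H, inner ℝ p.1 x = p.2

/-- A (closed, full-dimensional, not necessarily convex) polytope in `ℝ^d`. -/
structure IsPolytope {d : ℕ} (T : Set (E d)) : Prop where
  isCompact : IsCompact T
  closure_interior : closure (interior T) = T
  isConnected_interior : IsConnected (interior T)
  frontier_flat : InFinitelyManyHyperplanes (frontier T)

/-- A bounded polygonal (`d = 2`) or polyhedral (`d = 3`) domain. -/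
structure IsPolytopalDomain {d : ℕ} (Ω : Set (E d)) : Prop where
  isOpen : IsOpen Ω
  isConnected : IsConnected Ω
  isBounded : Bornology.IsBounded Ω
  interior_closure : interior (closure Ω) = Ω
  frontier_flat : InFinitelyManyHyperplanes (frontier Ω)

/-- A flat face in `ℝ^d`: an isometric affine copy of a polytope of `ℝ^(d-1)`. -/
def IsFlatFace {d : ℕ} (e : Set (E d)) : Prop :=
  ∃ (f : E (d - 1) →ᵃⁱ[ℝ] E d) (P : Set (E (d - 1))), IsPolytope P ∧ e = f '' P

/-- `n` is the unit outward normal to `T` on its flat face `e`: it is a unit vector orthogonal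
to `e`, and at almost every point of `e` the set `T` lies locally on the side of `-n`. -/
structure IsOutwardNormal {d : ℕ} (T e : Set (E d)) (n : E d) : Prop where
  norm_eq : ‖n‖ = 1
  orthogonal : ∀ x ∈ e, ∀ y ∈ e, inner ℝ (x - y) n = 0
  outward : ∀ᵐ x ∂(μHE[d - 1].restrict e), ∀ᶠ t : ℝ in 𝓝[>] 0,
    x - t • n ∈ interior T ∧ x + t • n ∉ T

/-- The unit outward normal to `T` on `e`. -/
def outwardNormal {d : ℕ} (T e : Set (E d)) : E d :=
  if h : ∃ n, IsOutwardNormal T e n then h.choose else 0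

/-- A finite partition `𝒯_h` of the domain `Ω` into polytopes, with its set `ℰ_h` of
edges (`d = 2`) or faces (`d = 3`). -/
structure Mesh {d : ℕ} (Ω : Set (E d)) where
  elems : Finset (Set (E d))
  faces : Finset (Set (E d))
  isPolytope : ∀ T ∈ elems, IsPolytope T
  disjoint_interior : ∀ T ∈ elems, ∀ T' ∈ elems, T ≠ T' → Disjoint (interior T) (interior T')
  cover : ⋃ T ∈ elems, T = closure Ω
  isFlatFace : ∀ e ∈ faces, IsFlatFace e
  faces_nonoverlapping : ∀ e ∈ faces, ∀ e' ∈ faces, e ≠ e' → μHE[d - 1] (e ∩ e') = 0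
  face_subset : ∀ e ∈ faces, ∃ T ∈ elems, e ⊆ frontier T
  frontier_eq : ∀ T ∈ elems, frontier T = ⋃ e ∈ faces.filter (fun e => e ⊆ frontier T), e
  exists_normal : ∀ T ∈ elems, ∀ e ∈ faces, e ⊆ frontier T → ∃ n, IsOutwardNormal T e n

/-- The edges/faces of the element `T`. -/
def Mesh.facesOf {d : ℕ} {Ω : Set (E d)} (M : Mesh Ω) (T : Set (E d)) : Finset (Set (E d)) :=
  M.faces.filter (fun e => e ⊆ frontier T)

/-- The constants of the shape-regularity conditions. -/
structure ShapeConstants where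
  ρv : ℝ
  ρe : ℝ
  κ : ℝ
  σ : ℝ
  θ₀ : ℝ
  γ : ℝ
  ρs : ℝ
  δ : ℝ
  m : ℕ
  N₀ : ℕ
  ρv_pos : 0 < ρv
  ρe_pos : 0 < ρe
  κ_pos : 0 < κ
  σ_pos : 0 < σ
  θ₀_lt : θ₀ < Real.pi / 2
  γ_pos : 0 < γ
  ρs_pos : 0 < ρs
  δ_pos : 0 < δ

/-- Shape regularity of a polytopal mesh with given constants. -/
structure Mesh.IsShapeRegular {d : ℕ} {Ω : Set (E d)} (M : Mesh Ω) (S : ShapeConstants) :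
    Prop where
  /-- Elements are not thin. -/
  vol_elem : ∀ T ∈ M.elems, S.ρv * Metric.diam T ^ d ≤ volume.real T
  /-- Faces are not thin. -/
  vol_face : ∀ e ∈ M.faces, S.ρe * Metric.diam e ^ (d - 1) ≤ μHE[d - 1].real e
  /-- Faces are not small. -/
  diam_face : ∀ T ∈ M.elems, ∀ e ∈ M.facesOf T, S.κ * Metric.diam T ≤ Metric.diam e
  /-- Each face `e` of `T` is the base of a pyramid contained in `T`, with apex `A`, of height at
  least `σ h_T`, that stands up above its base. -/
  pyramid : ∀ T ∈ M.elems, ∀ e ∈ M.facesOf T, ∃ A ∈ T,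
    (∀ x ∈ e, segment ℝ A x ⊆ T) ∧
    (∀ x ∈ e, S.σ * Metric.diam T ≤ inner ℝ (x - A) (outwardNormal T e)) ∧
    (∀ x ∈ e, InnerProductGeometry.angle (x - A) (outwardNormal T e) ≤ S.θ₀)
  /-- Each element has a shape-regular circumscribed simplex of comparable diameter, and each such
  simplex meets only boundedly many of the others. -/
  simplex : ∃ s : Set (E d) → Affine.Simplex ℝ (E d) d, ∀ T ∈ M.elems,
    T ⊆ (s T).closedInterior ∧
    S.ρs * Metric.diam (s T).closedInterior ^ d ≤ volume.real (s T).closedInterior ∧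
    Metric.diam (s T).closedInterior ≤ S.γ * Metric.diam T ∧
    (M.elems.filter
      (fun T' => ((s T).closedInterior ∩ (s T').closedInterior).Nonempty)).card ≤ S.m
  /-- The number of faces of an element is bounded. -/
  card_faces : ∀ T ∈ M.elems, (M.facesOf T).card ≤ S.N₀
  /-- No two faces of an element are coplanar, or nearly so: some point of `e` has distance at
  least `δ h_T` to the hyperplane spanned by `e'`. -/
  noncoplanar : ∀ T ∈ M.elems, ∀ e ∈ M.facesOf T, ∀ e' ∈ M.facesOf T, e ≠ e' →
    ∃ x ∈ e, S.δ * Metric.diam T ≤ Metric.infDist x (affineSpan ℝ e' : Set (E d))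

/-! ### Weak functions and the discrete weak gradient -/

/-- A weak function with polynomial components: `v₀` on each element, and `v_b`, single-valued, on
each face; a polynomial on a flat face is the restriction of a polynomial of `ℝ^d` of the same
degree. -/
structure WeakFn (d : ℕ) where
  v0 : Set (E d) → Poly d
  vb : Set (E d) → Poly d

/-- The global weak finite element space `V_h`: `v₀ ∈ P_k(T)` and `v_b ∈ P_q(e)`. -/
def Mesh.Vh {d : ℕ} {Ω : Set (E d)} (M : Mesh Ω) (k q : ℕ) : Set (WeakFn d) :=
  {v | (∀ T ∈ M.elems, (v.v0 T).totalDegree ≤ k) ∧ ∀ e ∈ M.faces, (v.vb e).totalDegree ≤ q}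

/-- The degree `r` of the discrete weak gradient on the element `T` with `N` faces:
`k - 1 + N` if `T` is convex, `k - 1 + 2N` otherwise (note `N ≥ 1`). -/
def Mesh.deg {d : ℕ} {Ω : Set (E d)} (M : Mesh Ω) (k : ℕ) (T : Set (E d)) : ℕ :=
  if Convex ℝ T then k + (M.facesOf T).card - 1 else k + 2 * (M.facesOf T).card - 1

/-- `g ∈ [P_r(T)]^d` is the discrete weak gradient on `T`, with faces `F`, of `{u₀, u_b}`:
`(g, φ)_T = -(u₀, ∇·φ)_T + ⟨u_b, φ·n⟩_∂T` for all `φ ∈ [P_r(T)]^d`. -/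
def IsDiscreteWeakGradient {d : ℕ} (r : ℕ) (T : Set (E d)) (F : Finset (Set (E d)))
    (u0 : Poly d) (ub : Set (E d) → Poly d) (g : Fin d → Poly d) : Prop :=
  (∀ i, (g i).totalDegree ≤ r) ∧
  ∀ φ : Fin d → Poly d, (∀ i, (φ i).totalDegree ≤ r) →
    ∫ x in T, ∑ i, pev (g i) x * pev (φ i) x =
      -(∫ x in T, pev u0 x * ∑ i, pev (MvPolynomial.pderiv i (φ i)) x)
      + ∑ e ∈ F, ∫ x in e, pev (ub e) x * ∑ i, pev (φ i) x * outwardNormal T e i ∂μHE[d - 1]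

/-! ### The discrete weak gradient is well defined -/

theorem continuous_pev {d : ℕ} (p : Poly d) : Continuous (pev p) := by
  unfold pev
  have h : Continuous fun y : Fin d → ℝ => MvPolynomial.eval y p := MvPolynomial.continuous_eval p
  exact h.comp (by fun_prop)

theorem IsFlatFace.isCompact {d : ℕ} {e : Set (E d)} (he : IsFlatFace e) : IsCompact e := by
  obtain ⟨f, P, hP, rfl⟩ := he
  exact hP.isCompact.image f.continuous

theorem IsFlatFace.measure_lt_top {d : ℕ} {e : Set (E d)} (he : IsFlatFace e) :
    μHE[d - 1] e < ⊤ := by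
  obtain ⟨f, P, hP, rfl⟩ := he
  rw [f.isometry.euclideanHausdorffMeasure_image,
    EuclideanSpace.euclideanHausdorffMeasure_eq_volume]
  exact hP.isCompact.measure_lt_top

theorem IsFlatFace.integrableOn {d : ℕ} {e : Set (E d)} (he : IsFlatFace e) {f : E d → ℝ}
    (hf : Continuous f) : IntegrableOn f e μHE[d - 1] := by
  obtain ⟨C, hC⟩ := he.isCompact.exists_bound_of_continuousOn hf.continuousOn
  refine Measure.integrableOn_of_bounded he.measure_lt_top.ne hf.aestronglyMeasurable (M := C) ?_
  filter_upwards [ae_restrict_mem he.isCompact.measurableSet] with x hx using hC x hx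

theorem IsPolytope.integrableOn {d : ℕ} {T : Set (E d)} (hT : IsPolytope T) {f : E d → ℝ}
    (hf : Continuous f) : IntegrableOn f T :=
  hf.continuousOn.integrableOn_compact hT.isCompact

/-- A polynomial that vanishes on a nonempty open set is zero. -/
theorem eq_zero_of_pev_eq_zero {d : ℕ} {U : Set (E d)} (hU : IsOpen U) (hne : U.Nonempty)
    {p : Poly d} (h : ∀ x ∈ U, pev p x = 0) : p = 0 := by
  obtain ⟨x, hx⟩ := hne
  let V : Set (Fin d → ℝ) := (fun y => WithLp.toLp 2 y) ⁻¹' U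
  have hV : IsOpen V := hU.preimage (by fun_prop)
  have hxV : (fun i => x i) ∈ V := hx
  obtain ⟨ε, hε, hb⟩ := Metric.isOpen_iff.1 hV _ hxV
  refine MvPolynomial.funext_set (fun i => Metric.ball (x i) ε) (fun i => ?_) (fun y hy => ?_)
  · rw [Real.ball_eq_Ioo]
    exact Set.Ioo_infinite (by linarith)
  · have : y ∈ V := hb (by
      rw [ball_pi _ hε]
      exact hy)
    simpa [pev] using h _ this

/-- The space `[P_r]^d`. -/
abbrev PolyVec (d r : ℕ) := Fin d → MvPolynomial.restrictTotalDegree (Fin d) ℝ r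

/-- For every polytope, the discrete weak gradient exists and is unique. -/
theorem existsUnique_isDiscreteWeakGradient {d : ℕ} (r : ℕ) {T : Set (E d)} (hT : IsPolytope T)
    {F : Finset (Set (E d))} (hF : ∀ e ∈ F, IsFlatFace e) (u0 : Poly d)
    (ub : Set (E d) → Poly d) : ∃! g, IsDiscreteWeakGradient r T F u0 ub g := by
  have hc := fun p : Poly d => continuous_pev p
  have hadd : ∀ (p q : Poly d) x, pev (p + q) x = pev p x + pev q x := by simp [pev]
  have hsmul : ∀ (a : ℝ) (p : Poly d) x, pev (a • p) x = a * pev p x := by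
    simp [pev, MvPolynomial.smul_eval]
  let B : PolyVec d r →ₗ[ℝ] PolyVec d r →ₗ[ℝ] ℝ := LinearMap.mk₂ ℝ
    (fun g φ => ∫ x in T, ∑ i, pev (g i : Poly d) x * pev (φ i : Poly d) x)
    (fun g g' φ => by
      rw [← integral_add (hT.integrableOn (by fun_prop)) (hT.integrableOn (by fun_prop))]
      simp [hadd, add_mul, Finset.sum_add_distrib])
    (fun a g φ => by
      rw [smul_eq_mul, ← integral_const_mul]
      simp [hsmul, Finset.mul_sum, mul_assoc])
    (fun g φ φ' => by
      rw [← integral_add (hT.integrableOn (by fun_prop)) (hT.integrableOn (by fun_prop))]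
      simp [hadd, mul_add, Finset.sum_add_distrib])
    (fun a g φ => by
      rw [smul_eq_mul, ← integral_const_mul]
      simp [hsmul, Finset.mul_sum, mul_left_comm])
  let L : PolyVec d r →ₗ[ℝ] ℝ :=
    { toFun := fun φ => -(∫ x in T, pev u0 x * ∑ i, pev (MvPolynomial.pderiv i (φ i : Poly d)) x)
        + ∑ e ∈ F, ∫ x in e, pev (ub e) x * ∑ i, pev (φ i : Poly d) x * outwardNormal T e i
            ∂μHE[d - 1]
      map_add' := fun φ φ' => by
        have h1 := integral_add (μ := volume.restrict T)
          (hT.integrableOn (f := fun x => pev u0 x *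
            ∑ i, pev (MvPolynomial.pderiv i (φ i : Poly d)) x) (by fun_prop))
          (hT.integrableOn (f := fun x => pev u0 x *
            ∑ i, pev (MvPolynomial.pderiv i (φ' i : Poly d)) x) (by fun_prop))
        have h2 : ∀ e ∈ F, _ := fun e he => integral_add (μ := μHE[d - 1].restrict e)
          ((hF e he).integrableOn (f := fun x => pev (ub e) x *
            ∑ i, pev (φ i : Poly d) x * outwardNormal T e i) (by fun_prop))
          ((hF e he).integrableOn (f := fun x => pev (ub e) x *
            ∑ i, pev (φ' i : Poly d) x * outwardNormal T e i) (by fun_prop))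
        simp only [Pi.add_apply, Submodule.coe_add, map_add, hadd, add_mul,
          Finset.sum_add_distrib, mul_add]
        rw [h1, Finset.sum_congr rfl h2, Finset.sum_add_distrib]
        ring
      map_smul' := fun a φ => by
        have e1 : ∀ x, pev u0 x * ∑ i, a * pev (MvPolynomial.pderiv i (φ i : Poly d)) x
            = a * (pev u0 x * ∑ i, pev (MvPolynomial.pderiv i (φ i : Poly d)) x) := fun x => by
          rw [← Finset.mul_sum]; ring
        have e2 : ∀ e x, pev (ub e) x * ∑ i, a * pev (φ i : Poly d) x * outwardNormal T e i
            = a * (pev (ub e) x * ∑ i, pev (φ i : Poly d) x * outwardNormal T e i) :=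
          fun e x => by
            simp only [mul_assoc, ← Finset.mul_sum]; ring
        simp only [Pi.smul_apply, Submodule.coe_smul, Derivation.map_smul, hsmul, e1, e2,
          integral_const_mul, RingHom.id_apply, smul_eq_mul]
        rw [← Finset.mul_sum]
        ring }
  have hinj : Function.Injective B := by
    rw [injective_iff_map_eq_zero]
    intro g hg
    have h0 : ∫ x in T, ∑ i, pev (g i : Poly d) x * pev (g i : Poly d) x = 0 :=
      congrArg (fun l : PolyVec d r →ₗ[ℝ] ℝ => l g) hg
    have hcont : Continuous fun x => ∑ i, pev (g i : Poly d) x * pev (g i : Poly d) x := by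
      fun_prop
    rw [setIntegral_eq_zero_iff_of_nonneg_ae
      (Eventually.of_forall fun x => Finset.sum_nonneg fun i _ => mul_self_nonneg _)
      (hT.integrableOn hcont)] at h0
    have h1 : (fun x => ∑ i, pev (g i : Poly d) x * pev (g i : Poly d) x)
        =ᵐ[volume.restrict (interior T)] fun _ => 0 :=
      ae_restrict_of_ae_restrict_of_subset interior_subset h0
    have h2 := Measure.eqOn_open_of_ae_eq h1 isOpen_interior hcont.continuousOn
      continuousOn_const
    funext i
    refine Subtype.ext (eq_zero_of_pev_eq_zero isOpen_interior hT.isConnected_interior.nonempty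
      fun x hx => ?_)
    have h3 := (Finset.sum_eq_zero_iff_of_nonneg fun i _ => mul_self_nonneg _).1 (h2 hx) i
      (Finset.mem_univ i)
    exact mul_self_eq_zero.1 h3
  have hsurj : Function.Surjective B :=
    (LinearMap.injective_iff_surjective_of_finrank_eq_finrank
      (Subspace.dual_finrank_eq (K := ℝ) (V := PolyVec d r)).symm).1 hinj
  have hmem : ∀ {p : Poly d}, p ∈ MvPolynomial.restrictTotalDegree (Fin d) ℝ r ↔
      p.totalDegree ≤ r := MvPolynomial.mem_restrictTotalDegree _ _ _
  obtain ⟨g, hg⟩ := hsurj L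
  refine ⟨fun i => g i, ⟨fun i => hmem.1 (g i).2, fun φ hφ => ?_⟩, fun g' hg' => ?_⟩
  · exact congrArg (fun l : PolyVec d r →ₗ[ℝ] ℝ => l fun i => ⟨φ i, hmem.2 (hφ i)⟩) hg
  · have : (fun i => ⟨g' i, hmem.2 (hg'.1 i)⟩ : PolyVec d r) = g := hinj (by
      rw [hg]
      refine LinearMap.ext fun φ => ?_
      exact hg'.2 (fun i => φ i) fun i => hmem.1 (φ i).2)
    rw [← this]

/-- The discrete weak gradient `∇_w v` on the element `T` (it exists and is unique, by
`existsUnique_isDiscreteWeakGradient`). -/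
def Mesh.weakGradient {d : ℕ} {Ω : Set (E d)} (M : Mesh Ω) (k : ℕ) (v : WeakFn d)
    (T : Set (E d)) : Fin d → Poly d :=
  if h : ∃ g, IsDiscreteWeakGradient (M.deg k T) T (M.facesOf T) (v.v0 T) v.vb g
  then h.choose else 0

/-! ### Coefficients -/

/-- `b ∈ [W^{1,∞}(Ω)]^d` with weak derivatives `Db i j = ∂_j b_i`; `b` is the representative that
is continuous up to the boundary. -/
structure IsW1Infty {d : ℕ} (Ω : Set (E d)) (b : E d → E d) (Db : Fin d → Fin d → E d → ℝ) :
    Prop where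
  continuousOn : ContinuousOn b (closure Ω)
  memLp : ∀ i, MemLp (fun x => b x i) ⊤ (volume.restrict Ω)
  memLp_deriv : ∀ i j, MemLp (Db i j) ⊤ (volume.restrict Ω)
  weak_deriv : ∀ i j, ∀ φ : E d → ℝ, ContDiff ℝ (⊤ : ℕ∞) φ → HasCompactSupport φ →
    tsupport φ ⊆ Ω →
    ∫ x in Ω, b x i * fderiv ℝ φ x (EuclideanSpace.single j 1) = -∫ x in Ω, Db i j x * φ x

/-- Convection and reaction coefficients on `Ω` with `c + ½ ∇·b ≥ c₀ > 0`. -/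
structure Coefficients {d : ℕ} (Ω : Set (E d)) where
  b : E d → E d
  Db : Fin d → Fin d → E d → ℝ
  c : E d → ℝ
  c₀ : ℝ
  isW1Infty : IsW1Infty Ω b Db
  integrable_c : IntegrableOn c Ω
  c₀_pos : 0 < c₀
  coercive : ∀ᵐ x ∂(volume.restrict Ω), c₀ ≤ c x + 1 / 2 * ∑ i, Db i i x

/-! ### The two norms -/

variable {d : ℕ} {Ω : Set (E d)}

/-- The convection and reaction terms on the element `T` that are common to both norms:
`½⟨b·n(v_b-v₀), v₀-v_b⟩_{∂T⁻} + ½⟨b·n(v₀-v_b), v₀-v_b⟩_{∂T⁺} + ((c+½∇·b)v₀, v₀)_T`. -/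
def convReact (M : Mesh Ω) (K : Coefficients Ω) (v : WeakFn d) (T : Set (E d)) : ℝ :=
  (∑ e ∈ M.facesOf T,
    (1 / 2 * ∫ x in {x ∈ e | inner ℝ (K.b x) (outwardNormal T e) < 0},
        inner ℝ (K.b x) (outwardNormal T e) * (pev (v.vb e) x - pev (v.v0 T) x)
          * (pev (v.v0 T) x - pev (v.vb e) x) ∂μHE[d - 1]
      + 1 / 2 * ∫ x in {x ∈ e | 0 < inner ℝ (K.b x) (outwardNormal T e)},
        inner ℝ (K.b x) (outwardNormal T e) * (pev (v.v0 T) x - pev (v.vb e) x)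
          * (pev (v.v0 T) x - pev (v.vb e) x) ∂μHE[d - 1]))
  + ∫ x in T, (K.c x + 1 / 2 * ∑ i, K.Db i i x) * pev (v.v0 T) x * pev (v.v0 T) x

/-- The discrete energy norm `|||v|||`. -/
def energyNorm (M : Mesh Ω) (K : Coefficients Ω) (ρ : ℝ) (k : ℕ) (v : WeakFn d) : ℝ :=
  √(∑ T ∈ M.elems,
    (ρ * (∫ x in T, ∑ i, pev (M.weakGradient k v T i) x ^ 2) + convReact M K v T))

/-- The discrete `H¹`-type norm `‖v‖_{1,h}`. -/
def norm1h (M : Mesh Ω) (K : Coefficients Ω) (ρ : ℝ) (v : WeakFn d) : ℝ :=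
  √(∑ T ∈ M.elems,
    (ρ * (∫ x in T, ∑ i, pev (MvPolynomial.pderiv i (v.v0 T)) x ^ 2) + convReact M K v T
      + (Metric.diam T)⁻¹ *
          ∑ e ∈ M.facesOf T, ∫ x in e, (pev (v.v0 T) x - pev (v.vb e) x) ^ 2 ∂μHE[d - 1]))

end WG

end

/-!
On every element `T` of size `h = diam T`, let `G`, `A` be the squared `L²` norms of the weak
gradient and of `∇v₀`, and let `J` be `h⁻¹` times the squared `L²(∂T)` norm of `v₀ - v_b`. Since the
convection and reaction terms are nonnegative (`convReact_nonneg`) and are common to both norms, it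
suffices to bound `G` by `A + J` and `A + J` by `G` with uniform constants
(`exists_local_equivalence`).

Integration by parts turns the definition of the weak gradient `g` into
`(g, φ)_T = (∇v₀, φ)_T + ⟨v_b - v₀, φ·n⟩_∂T` (`integral_weakGradient_mul`). This identity is tested
with three polynomial fields `φ`:
* `φ = g` bounds `G`, by the trace inequality for polynomials (`exists_weakGradient_le`);
* `φ = β ∇v₀`, where the bubble function `β` vanishes on all faces, has no boundary term and bounds
  `A` by `G` (`exists_gradient_le_weakGradient`);
* `φ = β Q n`, where `β` vanishes on all faces but `e`, `n` is the normal of `e` and `Q` extends the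
  jump `v₀ - v_b` on `e` constantly in the direction `n`, leaves the jump on `e` alone and bounds it
  by `A + G` (`exists_jump_le_weakGradient`).

The bubble functions are products of the heights above the hyperplanes of the faces, divided by `h`.
On a convex element the heights have a constant sign; otherwise they are squared. This accounts for
the two choices of the degree of the weak gradient (`exists_bubble`).

The uniformity of the constants rests on a single inequality of Remez type: on a subset of a ball
that fills a fixed fraction of it, the `L²` norm of a polynomial of bounded degree controls its
maximum over the ball, even after weighting by finitely many affine functions none of which is small
on the whole ball (`exists_weighted_sq_le_setIntegral`). It follows from the compactness of the set of normalized
polynomials and from the fact that nonzero polynomials vanish only on null sets. It is applied on the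
element and, in dimension one less, on its faces, where the heights above the other faces are not
small by non-coplanarity.

The divergence theorem for polynomials on a nonconvex polytope (`setIntegral_pderiv`) is proved by
Fubini's theorem along a coordinate axis. Almost every line in that direction crosses the boundary
only at points of a single face, transversally and along its outward normal (`ae_isRegularLine`);
there the fundamental theorem of calculus applies on the finitely many intervals that the line cuts
out of `T` (`setIntegral_deriv_eq_sum_jumps`). The change of variables from a face to its projection
has Jacobian `|n i|` (`abs_det_dropCoord_comp`).
-/

namespace WG

/-! ### Polynomial functions -/

section PolynomialFunctions

variable {d m n : ℕ}

@[simp] theorem pev_add (p q : Poly d) (x : E d) : pev (p + q) x = pev p x + pev q x := by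
  simp [pev]

@[simp] theorem pev_sub (p q : Poly d) (x : E d) : pev (p - q) x = pev p x - pev q x := by
  simp [pev]

@[simp] theorem pev_mul (p q : Poly d) (x : E d) : pev (p * q) x = pev p x * pev q x := by
  simp [pev]

@[simp] theorem pev_pow (p : Poly d) (j : ℕ) (x : E d) : pev (p ^ j) x = pev p x ^ j := by
  simp [pev]

@[simp] theorem pev_C (a : ℝ) (x : E d) : pev (MvPolynomial.C a) x = a := by
  simp [pev]

@[simp] theorem pev_zero (x : E d) : pev (0 : Poly d) x = 0 := by
  simp [pev]

@[simp] theorem pev_one (x : E d) : pev (1 : Poly d) x = 1 := by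
  simp [pev]

@[simp] theorem pev_X (i : Fin d) (x : E d) : pev (MvPolynomial.X i) x = x i := by
  simp [pev]

@[simp] theorem pev_sum {ι : Type*} (s : Finset ι) (p : ι → Poly d) (x : E d) :
    pev (∑ j ∈ s, p j) x = ∑ j ∈ s, pev (p j) x := by
  simp [pev]

@[simp] theorem pev_prod {ι : Type*} (s : Finset ι) (p : ι → Poly d) (x : E d) :
    pev (∏ j ∈ s, p j) x = ∏ j ∈ s, pev (p j) x := by
  simp [pev]

theorem exists_pev_comp_affine (A : E m →ᵃ[ℝ] E n) (p : Poly n) :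
    ∃ q : Poly m, q.totalDegree ≤ p.totalDegree ∧ ∀ x, pev q x = pev p (A x) := by
  let L : Fin n → Poly m := fun i =>
    ∑ j, MvPolynomial.C (A.linear (EuclideanSpace.single j 1) i) * MvPolynomial.X j
      + MvPolynomial.C (A 0 i)
  have hdeg : ∀ i, (L i).totalDegree ≤ 1 := fun i => by
    refine (MvPolynomial.totalDegree_add _ _).trans (max_le ?_ (by simp))
    refine MvPolynomial.totalDegree_finsetSum_le fun j _ => ?_
    refine (MvPolynomial.totalDegree_mul _ _).trans ?_
    simp
  have hev : ∀ i x, pev (L i) x = A x i := fun i x => by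
    have h1 : A x = A.linear x + A 0 := by
      have := A.map_vadd 0 x
      simpa using this
    have h2 : x = ∑ j, x j • (EuclideanSpace.single j 1 : E m) := by
      conv_lhs => rw [← (EuclideanSpace.basisFun (Fin m) ℝ).sum_repr x]
      simp
    have h3 : A.linear x i = ∑ j, x j * A.linear (EuclideanSpace.single j 1) i := by
      conv_lhs => rw [h2]
      rw [map_sum]
      simp [map_smul]
    rw [h1]
    simp only [L, pev_add, pev_sum, pev_mul, pev_C, pev_X, PiLp.add_apply, h3]
    simp only [mul_comm]
  refine ⟨MvPolynomial.aeval L p, ?_, fun x => ?_⟩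
  · rw [MvPolynomial.aeval_def, MvPolynomial.eval₂_eq']
    refine MvPolynomial.totalDegree_finsetSum_le fun s hs => ?_
    refine (MvPolynomial.totalDegree_mul _ _).trans ?_
    rw [MvPolynomial.algebraMap_eq, MvPolynomial.totalDegree_C, zero_add]
    refine (MvPolynomial.totalDegree_finsetProd _ _).trans ?_
    refine le_trans ?_ (MvPolynomial.le_totalDegree hs)
    rw [Finsupp.sum_fintype _ _ (fun _ => rfl)]
    refine Finset.sum_le_sum fun i _ => ?_
    refine (MvPolynomial.totalDegree_pow _ _).trans ?_
    exact (Nat.mul_le_mul_left _ (hdeg i)).trans (by simp)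
  · have : ∀ i, MvPolynomial.eval (fun i => x i) (L i) = A x i := fun i => hev i x
    unfold pev
    rw [MvPolynomial.aeval_def, MvPolynomial.eval₂_eq', MvPolynomial.eval_eq' (fun i => A x i) p]
    simp [this]

theorem totalDegree_pderiv_add_one_le (p : Poly d) (i : Fin d)
    (h : MvPolynomial.pderiv i p ≠ 0) :
    (MvPolynomial.pderiv i p).totalDegree + 1 ≤ p.totalDegree := by
  obtain ⟨s, hs, hd⟩ := Finset.exists_mem_eq_sup _ (MvPolynomial.support_nonempty.2 h)
    fun s => s.sum fun _ e => e
  change (MvPolynomial.pderiv i p).totalDegree = _ at hd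
  have hs' : s + Finsupp.single i 1 ∈ p.support := by
    rw [MvPolynomial.mem_support_iff, MvPolynomial.coeff_pderiv] at hs
    exact MvPolynomial.mem_support_iff.2 (left_ne_zero_of_mul hs)
  have h2 := MvPolynomial.le_totalDegree hs'
  rw [hd]
  refine le_trans (le_of_eq ?_) h2
  rw [Finsupp.sum_add_index' (fun _ => rfl) (fun _ _ _ => rfl)]
  simp [Finsupp.sum_fintype]

theorem hasDerivAt_pev_line (p : Poly d) (x : E d) (i : Fin d) (t : ℝ) :
    HasDerivAt (fun t : ℝ => pev p (x + t • EuclideanSpace.single i (1 : ℝ)))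
      (pev (MvPolynomial.pderiv i p) (x + t • EuclideanSpace.single i (1 : ℝ))) t := by
  induction p using MvPolynomial.induction_on with
  | C a => simpa using hasDerivAt_const t a
  | add p q hp hq => simpa using hp.fun_add hq
  | mul_X p j hp =>
    have hX : HasDerivAt (fun t : ℝ => (x + t • EuclideanSpace.single i (1 : ℝ)) j)
        (if i = j then 1 else 0) t := by
      by_cases h : i = j
      · subst h
        simpa using (hasDerivAt_id t).const_add (x i)
      · simpa [h, Ne.symm h] using hasDerivAt_const t (x j)
    simp only [pev_mul, pev_X, Derivation.leibniz, smul_eq_mul, pev_add, MvPolynomial.pderiv_X]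
    refine (hp.fun_mul hX).congr_deriv ?_
    by_cases h : i = j
    · subst h
      rw [Pi.single_eq_same, pev_one, if_pos rfl]
      ring
    · rw [Pi.single_eq_of_ne (Ne.symm h), pev_zero, if_neg h]
      ring

theorem volume_eval_eq_zero : ∀ {n : ℕ} {p : Poly n}, p ≠ 0 →
    volume {x : Fin n → ℝ | MvPolynomial.eval x p = 0} = 0
  | 0, p, hp => by
    obtain ⟨a, rfl⟩ := MvPolynomial.C_surjective (Fin 0) p
    have : a ≠ 0 := by rintro rfl; simp at hp
    simp [this]
  | n + 1, p, hp => by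
    have hne : MvPolynomial.finSuccEquiv ℝ n p ≠ 0 := by simpa using hp
    have hlead := volume_eval_eq_zero (Polynomial.leadingCoeff_ne_zero.2 hne)
    let e := MeasurableEquiv.piFinSuccAbove (fun _ : Fin (n + 1) => ℝ) 0
    have he := volume_preserving_piFinSuccAbove (fun _ : Fin (n + 1) => ℝ) 0
    have hmeas : MeasurableSet {x : Fin (n + 1) → ℝ | MvPolynomial.eval x p = 0} :=
      (isClosed_singleton.preimage (MvPolynomial.continuous_eval p)).measurableSet
    rw [← he.symm.measure_preimage hmeas.nullMeasurableSet, Measure.volume_eq_prod]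
    rw [Measure.prod_apply_symm (e.symm.measurable hmeas)]
    refine (lintegral_congr_ae ?_).trans lintegral_zero
    filter_upwards [compl_mem_ae_iff.2 hlead] with y hy
    have hq : Polynomial.map (MvPolynomial.eval y) (MvPolynomial.finSuccEquiv ℝ n p) ≠ 0 := by
      intro h0
      have := congrArg
        (fun g => Polynomial.coeff g (MvPolynomial.finSuccEquiv ℝ n p).natDegree) h0
      simp only [Polynomial.coeff_map, Polynomial.coeff_zero] at this
      exact hy this
    refine ((Polynomial.finite_setOfPred_isRoot hq).subset fun t ht => ?_).measure_zero _
    have ht' : MvPolynomial.eval (Fin.cons t y : Fin (n + 1) → ℝ) p = 0 := by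
      simpa [e, MeasurableEquiv.piFinSuccAbove, Fin.insertNthEquiv] using ht
    rwa [MvPolynomial.eval_eq_eval_mv_eval'] at ht'

theorem volume_pev_eq_zero {p : Poly n} (hp : p ≠ 0) : volume {x : E n | pev p x = 0} = 0 := by
  have h := (PiLp.volume_preserving_ofLp (Fin n)).quasiMeasurePreserving.preimage_null
    (volume_eval_eq_zero hp)
  exact h

end PolynomialFunctions

/-! ### A Remez-type inequality -/

section Remez

variable {n : ℕ}

/-- Small values of a polynomial fill only a small part of the unit ball, uniformly over all
polynomials of degree at most `r`: this follows by compactness of the unit sphere of coefficients,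
since a nonzero polynomial vanishes only on a null set. -/
theorem exists_volume_sublevel_unitBall_le (n r : ℕ) {α : ℝ} (hα : 0 < α) :
    ∃ ε : ℝ, 0 < ε ∧ ∀ p : Poly n, p.totalDegree ≤ r →
      ∀ z ∈ Metric.closedBall (0 : E n) 1,
        volume.real {x | x ∈ Metric.closedBall (0 : E n) 1 ∧ |pev p x| < ε * |pev p z|} ≤ α := by
  let V := MvPolynomial.restrictTotalDegree (Fin n) ℝ r
  let b := Module.finBasis ℝ V
  let B := Metric.closedBall (0 : E n) 1
  let P : (Fin (Module.finrank ℝ V) → ℝ) → Poly n := fun c => (b.equivFun.symm c : V)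
  have hP : ∀ c x, pev (P c) x = ∑ j, c j * pev (b j : Poly n) x := fun c x => by
    simp only [P, Module.Basis.equivFun_symm_apply]
    rw [Submodule.coe_sum, pev_sum]
    simp [pev, MvPolynomial.smul_eval]
  have hBc : IsCompact B := isCompact_closedBall _ _
  have hBfin : ∀ s ⊆ B, volume s ≠ ⊤ := fun s hs =>
    ((measure_mono hs).trans_lt hBc.measure_lt_top).ne
  choose K hK using fun j => hBc.exists_bound_of_continuousOn
    (continuous_pev (b j : Poly n)).continuousOn
  let C : ℝ := 1 + ∑ j, |K j|
  have hC : 0 < C := by positivity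
  have hPC : ∀ c, ∀ x ∈ B, |pev (P c) x| ≤ C * ‖c‖ := fun c x hx => by
    rw [hP]
    calc |∑ j, c j * pev (b j : Poly n) x| ≤ ∑ j, ‖c‖ * |K j| := by
          refine (Finset.abs_sum_le_sum_abs _ _).trans (Finset.sum_le_sum fun j _ => ?_)
          rw [abs_mul]
          refine mul_le_mul (norm_le_pi_norm c j) ?_ (abs_nonneg _) (norm_nonneg _)
          exact (hK j x hx).trans (le_abs_self _)
      _ = (∑ j, |K j|) * ‖c‖ := by rw [← Finset.mul_sum, mul_comm]
      _ ≤ C * ‖c‖ := by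
          gcongr
          simp [C]
  have hcomp : ∃ η : ℝ, 0 < η ∧ ∀ c ∈ Metric.sphere (0 : Fin (Module.finrank ℝ V) → ℝ) 1,
      volume.real {x | x ∈ B ∧ |pev (P c) x| < η} ≤ α := by
    refine (isCompact_sphere (0 : Fin (Module.finrank ℝ V) → ℝ) 1).induction_on
      (p := fun s => ∃ η : ℝ, 0 < η ∧ ∀ c ∈ s, volume.real {x | x ∈ B ∧ |pev (P c) x| < η} ≤ α)
      ⟨1, one_pos, by simp⟩ ?_ ?_ ?_
    · rintro s t hst ⟨η, hη, h⟩
      exact ⟨η, hη, fun c hc => h c (hst hc)⟩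
    · rintro s t ⟨η, hη, h⟩ ⟨η', hη', h'⟩
      refine ⟨min η η', lt_min hη hη', ?_⟩
      rintro c (hc | hc)
      · refine (measureReal_mono ?_ (hBfin _ fun x hx => hx.1)).trans (h c hc)
        exact fun x hx => ⟨hx.1, hx.2.trans_le (min_le_left _ _)⟩
      · refine (measureReal_mono ?_ (hBfin _ fun x hx => hx.1)).trans (h' c hc)
        exact fun x hx => ⟨hx.1, hx.2.trans_le (min_le_right _ _)⟩
    · intro c₀ hc₀
      have hne : P c₀ ≠ 0 := by
        intro h0
        have : c₀ = 0 := by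
          apply b.equivFun.symm.injective
          rw [map_zero]
          exact Subtype.ext h0
        simp [this] at hc₀
      obtain ⟨η, hη, hηα⟩ : ∃ η : ℝ, 0 < η ∧
          volume.real {x | x ∈ B ∧ |pev (P c₀) x| < η} ≤ α := by
        let s : ℕ → Set (E n) := fun k => {x | x ∈ B ∧ |pev (P c₀) x| ≤ 1 / ((k : ℝ) + 1)}
        have hs : ∀ k, MeasurableSet (s k) := fun k =>
          (hBc.isClosed.inter (isClosed_le (continuous_pev _).abs continuous_const)).measurableSet
        have hanti : Antitone s := fun k l hkl x hx =>
          ⟨hx.1, hx.2.trans (one_div_le_one_div_of_le (by positivity) (by gcongr))⟩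
        have hlim := tendsto_measure_iInter_atTop (μ := volume)
          (fun k => (hs k).nullMeasurableSet) hanti ⟨0, hBfin _ fun x hx => hx.1⟩
        have hzero : volume (⋂ k, s k) = 0 := by
          refine measure_mono_null (fun x hx => ?_) (volume_pev_eq_zero hne)
          have h1 : ∀ k : ℕ, |pev (P c₀) x| ≤ 1 / ((k : ℝ) + 1) := fun k =>
            (Set.mem_iInter.1 hx k).2
          have h2 : |pev (P c₀) x| ≤ 0 :=
            ge_of_tendsto' (tendsto_one_div_add_atTop_nhds_zero_nat (𝕜 := ℝ)) h1
          exact abs_eq_zero.1 (le_antisymm h2 (abs_nonneg _))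
        rw [hzero] at hlim
        obtain ⟨k, hk⟩ := (hlim.eventually (gt_mem_nhds (ENNReal.ofReal_pos.2 hα))).exists
        refine ⟨1 / ((k : ℝ) + 1), by positivity, ?_⟩
        refine (measureReal_mono (s₂ := s k) (fun x hx => ⟨hx.1, hx.2.le⟩)
          (hBfin _ fun x hx => hx.1)).trans ?_
        exact ENNReal.toReal_le_of_le_ofReal hα.le hk.le
      refine ⟨Metric.ball c₀ (η / (2 * C)),
        mem_nhdsWithin_of_mem_nhds (Metric.ball_mem_nhds _ (by positivity)), η / 2, by positivity,
        fun c hc => ?_⟩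
      refine (measureReal_mono ?_ (hBfin _ fun x hx => hx.1)).trans hηα
      rintro x ⟨hxB, hx⟩
      refine ⟨hxB, ?_⟩
      have h1 : pev (P c₀) x = pev (P c) x + pev (P (c₀ - c)) x := by
        simp only [hP, Pi.sub_apply, sub_mul, Finset.sum_sub_distrib]
        ring
      have h2 : |pev (P (c₀ - c)) x| < η / 2 := by
        refine (hPC _ x hxB).trans_lt ?_
        rw [Metric.mem_ball, dist_comm, dist_eq_norm, lt_div_iff₀ (by positivity)] at hc
        linarith
      rw [h1]
      linarith [abs_add_le (pev (P c) x) (pev (P (c₀ - c)) x)]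
  obtain ⟨η, hη, hsub⟩ := hcomp
  refine ⟨η / C, by positivity, fun p hp z hz => ?_⟩
  have hpV : p ∈ V := (MvPolynomial.mem_restrictTotalDegree _ _ _).2 hp
  let c := b.equivFun ⟨p, hpV⟩
  have hpc : P c = p := by simp only [P, c, LinearEquiv.symm_apply_apply]
  rw [← hpc]
  by_cases hc0 : ‖c‖ = 0
  · have hcz : pev (P c) z = 0 :=
      abs_eq_zero.1 (le_antisymm (by simpa [hc0] using hPC c z hz) (abs_nonneg _))
    have : {x | x ∈ Metric.closedBall (0 : E n) 1 ∧ |pev (P c) x| < η / C * |pev (P c) z|} = ∅ := by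
      ext x
      simp [hcz]
    rw [this]
    simpa using hα.le
  · have hcpos : 0 < ‖c‖ := lt_of_le_of_ne (norm_nonneg _) (Ne.symm hc0)
    refine (measureReal_mono ?_ (hBfin _ fun x hx => hx.1)).trans
      (hsub (‖c‖⁻¹ • c) (by simp [norm_smul, hc0]))
    rintro x ⟨hxB, hx⟩
    refine ⟨hxB, ?_⟩
    have h1 : pev (P (‖c‖⁻¹ • c)) x = ‖c‖⁻¹ * pev (P c) x := by
      simp [hP, Finset.mul_sum, mul_assoc]
    rw [h1, abs_mul, abs_of_pos (inv_pos.2 hcpos), inv_mul_lt_iff₀ hcpos]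
    calc |pev (P c) x| < η / C * |pev (P c) z| := hx
      _ ≤ η / C * (C * ‖c‖) := by gcongr; exact hPC c z hz
      _ = ‖c‖ * η := by field_simp

open scoped Pointwise in
theorem exists_volume_sublevel_le (n r : ℕ) {α : ℝ} (hα : 0 < α) :
    ∃ ε : ℝ, 0 < ε ∧ ∀ p : Poly n, p.totalDegree ≤ r → ∀ (x₀ : E n) (R : ℝ), 0 < R →
      ∀ z ∈ Metric.closedBall x₀ R,
        volume.real {x | x ∈ Metric.closedBall x₀ R ∧ |pev p x| < ε * |pev p z|} ≤ α * R ^ n := by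
  obtain ⟨ε, hε, h⟩ := exists_volume_sublevel_unitBall_le n r hα
  refine ⟨ε, hε, fun p hp x₀ R hR z hz => ?_⟩
  obtain ⟨q, hq, hqp⟩ := exists_pev_comp_affine (AffineMap.homothety x₀ R +
    AffineMap.const ℝ (E n) (R • x₀) : E n →ᵃ[ℝ] E n) p
  have hq' : ∀ x, pev q x = pev p (x₀ + R • x) := fun x => by
    rw [hqp]
    congr 1
    simp [AffineMap.homothety_apply, smul_sub]
    abel
  have hmem : ∀ x ∈ Metric.closedBall x₀ R, R⁻¹ • (x - x₀) ∈ Metric.closedBall (0 : E n) 1 :=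
    fun x hx => by
      rw [mem_closedBall_iff_norm] at hx
      rw [mem_closedBall_zero_iff, norm_smul, norm_inv, Real.norm_of_nonneg hR.le,
        inv_mul_le_iff₀ hR]
      simpa using hx
  have hback : ∀ x : E n, x₀ + R • (R⁻¹ • (x - x₀)) = x := fun x => by
    rw [smul_inv_smul₀ hR.ne']; abel
  have h1 := h q (hq.trans hp) _ (hmem z hz)
  simp only [hq', hback] at h1
  set S : Set (E n) := {x | x ∈ Metric.closedBall (0 : E n) 1 ∧
    |pev p (x₀ + R • x)| < ε * |pev p z|} with hS
  have hsub : {x | x ∈ Metric.closedBall x₀ R ∧ |pev p x| < ε * |pev p z|} ⊆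
      (fun x => x₀ + x) '' (R • S) := by
    rintro x ⟨hxB, hx⟩
    refine ⟨R • (R⁻¹ • (x - x₀)), ⟨_, ⟨hmem x hxB, ?_⟩, rfl⟩, hback x⟩
    rwa [hback]
  have hSfin : volume S ≠ ⊤ := ((measure_mono fun x hx => hx.1).trans_lt
    (isCompact_closedBall (0 : E n) 1).measure_lt_top).ne
  have hvol : volume ((fun x => x₀ + x) '' (R • S)) = ENNReal.ofReal (R ^ n) * volume S := by
    rw [Set.image_add_left, measure_preimage_add, Measure.addHaar_smul]
    simp [abs_of_pos hR]
  refine (measureReal_mono hsub ?_).trans ?_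
  · rw [hvol]
    exact ENNReal.mul_ne_top ENNReal.ofReal_ne_top hSfin
  · rw [measureReal_def, hvol, ENNReal.toReal_mul, ENNReal.toReal_ofReal (by positivity),
      mul_comm]
    gcongr
    exact h1

/-- On a subset `A` of a ball that fills a fixed fraction of it, the square of a polynomial
controls its values on the whole ball, even after weighting by the squares of finitely many affine
functions none of which is small on the whole ball. -/
theorem exists_weighted_sq_le_setIntegral (n r N : ℕ) {ϱ δ : ℝ} (hϱ : 0 < ϱ) (hδ : 0 < δ) :
    ∃ c : ℝ, 0 < c ∧ ∀ (x₀ : E n) (R : ℝ), 0 < R → ∀ A : Set (E n), MeasurableSet A →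
      A ⊆ Metric.closedBall x₀ R → ϱ * R ^ n ≤ volume.real A →
      ∀ (ι : Type) (J : Finset ι) (w : ι → Poly n), J.card ≤ N →
      (∀ j ∈ J, (w j).totalDegree ≤ 1) →
      (∀ j ∈ J, ∃ z ∈ Metric.closedBall x₀ R, δ ≤ |pev (w j) z|) →
      ∀ p : Poly n, p.totalDegree ≤ r → ∀ z ∈ Metric.closedBall x₀ R,
        c * R ^ n * pev p z ^ 2 ≤ ∫ x in A, (∏ j ∈ J, pev (w j) x) ^ 2 * pev p x ^ 2 := by
  obtain ⟨ε, hε, h⟩ := exists_volume_sublevel_le n (max r 1)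
    (α := ϱ / (2 * ((N : ℝ) + 1))) (by positivity)
  let τ := min 1 (ε * δ)
  have hτ : 0 < τ := lt_min one_pos (by positivity)
  refine ⟨(τ ^ N) ^ 2 * ε ^ 2 * (ϱ / 2), by positivity, ?_⟩
  intro x₀ R hR A hA hAB hAvol ι J w hJ hw hwδ p hp z hz
  choose! y hyB hy using hwδ
  let B := Metric.closedBall x₀ R
  have hBc : IsCompact B := isCompact_closedBall _ _
  have hBfin : ∀ s ⊆ B, volume s ≠ ⊤ := fun s hs =>
    ((measure_mono hs).trans_lt hBc.measure_lt_top).ne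
  let S : Poly n → E n → Set (E n) := fun q u => {x | x ∈ B ∧ |pev q x| < ε * |pev q u|}
  have hSmeas : ∀ q u, MeasurableSet (S q u) := fun q u =>
    hBc.isClosed.measurableSet.inter
      (isOpen_lt (continuous_pev q).abs continuous_const).measurableSet
  let Bad : Set (E n) := S p z ∪ ⋃ j ∈ J, S (w j) (y j)
  have hBadmeas : MeasurableSet Bad :=
    (hSmeas _ _).union (Finset.measurableSet_biUnion _ fun j _ => hSmeas _ _)
  have hBadB : Bad ⊆ B := Set.union_subset (fun x hx => hx.1)
    (Set.iUnion₂_subset fun j _ x hx => hx.1)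
  have hBadvol : volume.real Bad ≤ ϱ / 2 * R ^ n := by
    refine (measureReal_union_le _ _).trans ?_
    have h1 := h p (hp.trans (le_max_left _ _)) x₀ R hR z hz
    have h2 : volume.real (⋃ j ∈ J, S (w j) (y j)) ≤
        ∑ j ∈ J, ϱ / (2 * ((N : ℝ) + 1)) * R ^ n :=
      (measureReal_biUnion_finset_le _ _).trans (Finset.sum_le_sum fun j hj =>
        h (w j) ((hw j hj).trans (le_max_right _ _)) x₀ R hR (y j) (hyB j hj))
    rw [Finset.sum_const, nsmul_eq_mul] at h2
    have hJ' : (J.card : ℝ) ≤ N := by exact_mod_cast hJ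
    have h3 : (J.card : ℝ) * (ϱ / (2 * ((N : ℝ) + 1)) * R ^ n) ≤
        N * (ϱ / (2 * ((N : ℝ) + 1)) * R ^ n) := by gcongr
    have h4 : ϱ / (2 * ((N : ℝ) + 1)) * R ^ n + N * (ϱ / (2 * ((N : ℝ) + 1)) * R ^ n) =
        ϱ / 2 * R ^ n := by field_simp; ring
    calc _ ≤ ϱ / (2 * ((N : ℝ) + 1)) * R ^ n + N * (ϱ / (2 * ((N : ℝ) + 1)) * R ^ n) :=
          add_le_add h1 (h2.trans h3)
      _ = _ := h4
  have hgood : ϱ / 2 * R ^ n ≤ volume.real (A \ Bad) := by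
    have := le_measureReal_sdiff (μ := volume) (s₁ := A) (s₂ := Bad) (hBfin _ hBadB)
    linarith
  have hcont : Continuous fun x => (∏ j ∈ J, pev (w j) x) ^ 2 * pev p x ^ 2 :=
    ((continuous_finsetProd _ fun j _ => continuous_pev (w j)).pow 2).mul
      ((continuous_pev p).pow 2)
  have hint : IntegrableOn (fun x => (∏ j ∈ J, pev (w j) x) ^ 2 * pev p x ^ 2) A :=
    (hcont.continuousOn.integrableOn_compact hBc).mono_set hAB
  have hlow : ∀ x ∈ A \ Bad, (τ ^ N) ^ 2 * (ε ^ 2 * pev p z ^ 2) ≤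
      (∏ j ∈ J, pev (w j) x) ^ 2 * pev p x ^ 2 := by
    rintro x ⟨hxA, hx⟩
    have hxB := hAB hxA
    have h1 : ε * |pev p z| ≤ |pev p x| := by
      by_contra! hlt
      exact hx (Or.inl ⟨hxB, hlt⟩)
    have h2 : ∀ j ∈ J, τ ≤ |pev (w j) x| := fun j hj => by
      have : ε * |pev (w j) (y j)| ≤ |pev (w j) x| := by
        by_contra! hlt
        exact hx (Or.inr (Set.mem_biUnion hj ⟨hxB, hlt⟩))
      refine ((min_le_right _ _).trans ?_).trans this
      gcongr
      exact hy j hj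
    have h3 : τ ^ N ≤ |∏ j ∈ J, pev (w j) x| := by
      rw [Finset.abs_prod]
      calc τ ^ N ≤ τ ^ J.card := pow_le_pow_of_le_one hτ.le (min_le_left _ _) hJ
        _ = ∏ j ∈ J, τ := by simp
        _ ≤ _ := Finset.prod_le_prod (fun _ _ => hτ.le) h2
    rw [← sq_abs (∏ j ∈ J, pev (w j) x), ← sq_abs (pev p x), ← sq_abs (pev p z), ← mul_pow ε]
    gcongr
  calc (τ ^ N) ^ 2 * ε ^ 2 * (ϱ / 2) * R ^ n * pev p z ^ 2
      = (τ ^ N) ^ 2 * (ε ^ 2 * pev p z ^ 2) * (ϱ / 2 * R ^ n) := by ring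
    _ ≤ (τ ^ N) ^ 2 * (ε ^ 2 * pev p z ^ 2) * volume.real (A \ Bad) := by gcongr
    _ ≤ ∫ x in A \ Bad, (∏ j ∈ J, pev (w j) x) ^ 2 * pev p x ^ 2 :=
        setIntegral_ge_of_const_le_real (hA.diff hBadmeas)
          (hBfin _ (Set.sdiff_subset.trans hAB)) hlow (hint.mono_set Set.sdiff_subset)
    _ ≤ _ := setIntegral_mono_set hint (Eventually.of_forall fun x => by positivity)
        (LE.le.eventuallyLE Set.sdiff_subset)

end Remez

/-! ### Integration over a compact subset of the line with finitely many jumps -/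

/-- If a compact set `S ⊆ ℝ` has its boundary at the points `z j`, with `S` to the left of `z j`
when `s j = 1` and to the right when `s j = -1`, then integrating a derivative over `S` gives the
signed sum of boundary values. -/
theorem setIntegral_deriv_eq_sum_jumps {ι : Type*} (J : Finset ι) (z s : ι → ℝ)
    (hz : Set.InjOn z J) {S : Set ℝ} (hS : IsCompact S)
    (hloc : ∀ t, (∀ j ∈ J, t ≠ z j) → (∀ᶠ t' in 𝓝 t, t' ∈ S) ∨ ∀ᶠ t' in 𝓝 t, t' ∉ S)
    (hjump : ∀ j ∈ J,
      (s j = 1 ∧ (∀ᶠ t in 𝓝[<] z j, t ∈ S) ∧ ∀ᶠ t in 𝓝[>] z j, t ∉ S) ∨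
      (s j = -1 ∧ (∀ᶠ t in 𝓝[<] z j, t ∉ S) ∧ ∀ᶠ t in 𝓝[>] z j, t ∈ S))
    {G G' : ℝ → ℝ} (hG : ∀ t, HasDerivAt G (G' t) t) (hG' : Continuous G') :
    ∫ t in S, G' t = ∑ j ∈ J, s j * G (z j) := by
  -- `θ j` is the indicator of the half-line below `z j`; the indicator of `S` is `∑ s j * θ j`.
  let θ : ι → ℝ → ℝ := fun j t => if t < z j then 1 else 0
  let χ : ℝ → ℝ := S.indicator 1
  have hθ : ∀ j t, t ≠ z j → ∀ᶠ t' in 𝓝 t, θ j t' = θ j t := fun j t ht => by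
    rcases lt_or_gt_of_ne ht with h | h
    · filter_upwards [Iio_mem_nhds h] with t' ht'
      simp only [θ, if_pos h, if_pos (Set.mem_Iio.1 ht')]
    · filter_upwards [Ioi_mem_nhds h] with t' ht'
      simp only [θ, if_neg (not_lt.2 h.le), if_neg (not_lt.2 (Set.mem_Ioi.1 ht').le)]
  let D : ℝ → ℝ := fun t => χ t - ∑ j ∈ J, s j * θ j t
  have hD : ∀ t, ∃ c, (∀ᶠ t' in 𝓝[≠] t, D t' = c) ∧ ((∀ j ∈ J, t ≠ z j) → D t = c) := by
    intro t
    by_cases ht : ∀ j ∈ J, t ≠ z j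
    · refine ⟨D t, eventually_nhdsWithin_of_eventually_nhds ?_, fun _ => rfl⟩
      have h1 : ∀ᶠ t' in 𝓝 t, ∀ j ∈ J, θ j t' = θ j t :=
        (Finset.eventually_all J).2 fun j hj => hθ j t (ht j hj)
      have h2 : ∀ᶠ t' in 𝓝 t, χ t' = χ t := by
        rcases hloc t ht with h | h
        · filter_upwards [h] with t' ht'
          simp [χ, ht', h.self_of_nhds]
        · filter_upwards [h] with t' ht'
          simp [χ, ht', h.self_of_nhds]
      filter_upwards [h1, h2] with t' h1 h2
      simp only [D, h2]
      congr 1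
      exact Finset.sum_congr rfl fun j hj => by rw [h1 j hj]
    · push Not at ht
      obtain ⟨j₀, hj₀, rfl⟩ := ht
      have h1 : ∀ᶠ t' in 𝓝 (z j₀), ∀ j ∈ J.erase j₀, θ j t' = θ j (z j₀) :=
        (Finset.eventually_all _).2 fun j hj => hθ j _ fun h =>
          Finset.ne_of_mem_erase hj (hz (Finset.mem_of_mem_erase hj) hj₀ h.symm)
      have hsplit : ∀ t', (∀ j ∈ J.erase j₀, θ j t' = θ j (z j₀)) →
          D t' = χ t' - s j₀ * θ j₀ t' - ∑ j ∈ J.erase j₀, s j * θ j (z j₀) := fun t' h => by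
        simp only [D]
        rw [← Finset.add_sum_erase _ _ hj₀, ← sub_sub]
        congr 1
        exact Finset.sum_congr rfl fun j hj => by rw [h j hj]
      have hne : ∀ c, ((∀ j ∈ J, z j₀ ≠ z j) → D (z j₀) = c) := fun c h => absurd rfl (h j₀ hj₀)
      rw [← Set.Iio_union_Ioi, nhdsWithin_union]
      rcases hjump j₀ hj₀ with ⟨hs, hl, hr⟩ | ⟨hs, hl, hr⟩
      · refine ⟨0 - ∑ j ∈ J.erase j₀, s j * θ j (z j₀), eventually_sup.2 ⟨?_, ?_⟩, hne _⟩
        · filter_upwards [hl, eventually_nhdsWithin_of_eventually_nhds h1, self_mem_nhdsWithin]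
            with t' h h1 h2
          rw [hsplit t' h1]
          simp [χ, θ, h, hs, Set.mem_Iio.1 h2]
        · filter_upwards [hr, eventually_nhdsWithin_of_eventually_nhds h1, self_mem_nhdsWithin]
            with t' h h1 h2
          rw [hsplit t' h1]
          simp [χ, θ, h, not_lt.2 (Set.mem_Ioi.1 h2).le]
      · refine ⟨1 - ∑ j ∈ J.erase j₀, s j * θ j (z j₀), eventually_sup.2 ⟨?_, ?_⟩, hne _⟩
        · filter_upwards [hl, eventually_nhdsWithin_of_eventually_nhds h1, self_mem_nhdsWithin]
            with t' h h1 h2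
          rw [hsplit t' h1]
          simp [χ, θ, h, hs, Set.mem_Iio.1 h2]
        · filter_upwards [hr, eventually_nhdsWithin_of_eventually_nhds h1, self_mem_nhdsWithin]
            with t' h h1 h2
          rw [hsplit t' h1]
          simp [χ, θ, h, not_lt.2 (Set.mem_Ioi.1 h2).le]
  choose c hc hcD using hD
  have hconst : IsLocallyConstant c := by
    rw [IsLocallyConstant.iff_eventually_eq]
    intro t
    have h1 := eventually_eventually_nhdsWithin.2 (hc t)
    rw [eventually_nhdsWithin_iff] at h1
    filter_upwards [h1] with y hy
    by_cases hyt : y = t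
    · rw [hyt]
    · have h2 := hy hyt
      rw [(isOpen_compl_singleton).nhdsWithin_eq hyt] at h2
      obtain ⟨x, hx1, hx2⟩ := ((h2.filter_mono nhdsWithin_le_nhds).and (hc y)).exists
      rw [← hx1, ← hx2]
  obtain ⟨b, hb⟩ : ∃ b : ℝ, ∀ t ∈ S, t < b :=
    let ⟨b, hb⟩ := hS.bddAbove
    ⟨b + 1, fun t ht => (hb ht).trans_lt (lt_add_one b)⟩
  obtain ⟨a, ha⟩ : ∃ a : ℝ, ∀ t ∈ S, a < t :=
    let ⟨a, ha⟩ := hS.bddBelow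
    ⟨a - 1, fun t ht => (sub_one_lt a).trans_le (ha ht)⟩
  obtain ⟨b', hb'S, hb'z⟩ : ∃ b' : ℝ, b ≤ b' ∧ ∀ j ∈ J, z j < b' :=
    ((eventually_ge_atTop b).and
      ((Finset.eventually_all J).2 fun j _ => eventually_gt_atTop (z j))).exists
  obtain ⟨a', ha'S, ha'z⟩ : ∃ a' : ℝ, a' ≤ a ∧ ∀ j ∈ J, a' < z j :=
    ((eventually_le_atBot a).and
      ((Finset.eventually_all J).2 fun j _ => eventually_lt_atBot (z j))).exists
  have hc0 : ∀ t, c t = 0 := fun t => by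
    rw [hconst.apply_eq_of_isPreconnected isPreconnected_univ (Set.mem_univ t)
      (Set.mem_univ b'), ← hcD b' fun j hj => (hb'z j hj).ne']
    have : b' ∉ S := fun h => absurd (hb b' h) (not_lt.2 hb'S)
    simp only [D, χ, θ, Set.indicator_of_notMem this]
    rw [Finset.sum_eq_zero fun j hj => by rw [if_neg (not_lt.2 (hb'z j hj).le), mul_zero],
      sub_zero]
  have hD0 : ∀ t, (∀ j ∈ J, t ≠ z j) → χ t = ∑ j ∈ J, s j * θ j t := fun t ht =>
    sub_eq_zero.1 ((hcD t ht).trans (hc0 t))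
  have hsum : ∑ j ∈ J, s j = 0 := by
    have h := hD0 a' fun j hj => (ha'z j hj).ne
    have : a' ∉ S := fun h => absurd (ha a' h) (not_lt.2 ha'S)
    simp only [χ, θ, Set.indicator_of_notMem this] at h
    rw [h]
    exact Finset.sum_congr rfl fun j hj => by rw [if_pos (ha'z j hj), mul_one]
  have hae : (S.indicator G') =ᵐ[volume]
      fun t => ∑ j ∈ J, s j * (Set.Ioo a' (z j)).indicator G' t := by
    have hfin : ((J.image z : Finset ℝ) : Set ℝ).Finite := Finset.finite_toSet _
    filter_upwards [compl_mem_ae_iff.2 (hfin.measure_zero volume)] with t ht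
    have ht' : ∀ j ∈ J, t ≠ z j := fun j hj h => ht (by
      rw [h]
      exact Finset.mem_coe.2 (Finset.mem_image_of_mem z hj))
    have h1 : S.indicator G' t = χ t * G' t := by
      by_cases h : t ∈ S <;> simp [χ, h]
    by_cases hta : a' < t
    · rw [h1, hD0 t ht', Finset.sum_mul]
      refine Finset.sum_congr rfl fun j _ => ?_
      by_cases h : t < z j <;> simp [θ, h, hta]
    · have : t ∉ S := fun h => hta (ha'S.trans_lt (ha t h))
      simp [this, hta]
  rw [← integral_indicator hS.isClosed.measurableSet, integral_congr_ae hae,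
    integral_finsetSum]
  · have h1 : ∀ j ∈ J, ∫ t, s j * (Set.Ioo a' (z j)).indicator G' t = s j * (G (z j) - G a') :=
      fun j hj => by
        rw [integral_const_mul, integral_indicator measurableSet_Ioo, ← integral_Ioc_eq_integral_Ioo,
          ← intervalIntegral.integral_of_le (ha'z j hj).le,
          intervalIntegral.integral_eq_sub_of_hasDerivAt (fun t _ => hG t)
            (hG'.intervalIntegrable _ _)]
    rw [Finset.sum_congr rfl h1]
    simp only [mul_sub, Finset.sum_sub_distrib, ← Finset.sum_mul, hsum, zero_mul, sub_zero]
  · intro j _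
    refine Integrable.const_mul ?_ _
    rw [integrable_indicator_iff measurableSet_Ioo]
    exact (hG'.continuousOn.integrableOn_compact isCompact_Icc).mono_set Set.Ioo_subset_Icc_self

/-! ### Coordinate lines and coordinate projections -/

section Coordinates

variable {m : ℕ}

/-- The projection of `ℝ^(m+1)` to `ℝ^m` that forgets the `i`-th coordinate. -/
noncomputable def dropCoord (i : Fin (m + 1)) : E (m + 1) →ₗ[ℝ] E m where
  toFun x := WithLp.toLp 2 fun k => x (i.succAbove k)
  map_add' _ _ := rfl
  map_smul' _ _ := rfl

/-- The point of the coordinate line in direction `i` over `y` whose `i`-th coordinate is `t`. -/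
noncomputable def coordLine (i : Fin (m + 1)) (y : E m) (t : ℝ) : E (m + 1) :=
  WithLp.toLp 2 (i.insertNth t fun k => y k)

@[simp] theorem dropCoord_apply (i : Fin (m + 1)) (x : E (m + 1)) (k : Fin m) :
    dropCoord i x k = x (i.succAbove k) := rfl

@[simp] theorem coordLine_apply_same (i : Fin (m + 1)) (y : E m) (t : ℝ) :
    coordLine i y t i = t := by
  simp [coordLine]

@[simp] theorem coordLine_apply_succAbove (i : Fin (m + 1)) (y : E m) (t : ℝ) (k : Fin m) :
    coordLine i y t (i.succAbove k) = y k := by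
  simp [coordLine]

@[simp] theorem dropCoord_coordLine (i : Fin (m + 1)) (y : E m) (t : ℝ) :
    dropCoord i (coordLine i y t) = y := by
  ext k
  simp

theorem coordLine_dropCoord (i : Fin (m + 1)) (x : E (m + 1)) :
    coordLine i (dropCoord i x) (x i) = x := by
  ext k
  induction k using i.succAboveCases <;> simp

theorem coordLine_eq_add_smul (i : Fin (m + 1)) (y : E m) (t t₀ : ℝ) :
    coordLine i y t = coordLine i y t₀ + (t - t₀) • EuclideanSpace.single i (1 : ℝ) := by
  ext k
  induction k using i.succAboveCases <;> simp

theorem continuous_coordLine (i : Fin (m + 1)) (y : E m) : Continuous (coordLine i y) := by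
  have : coordLine i y =
      fun t => coordLine i y 0 + (t - 0) • EuclideanSpace.single i (1 : ℝ) :=
    funext fun t => coordLine_eq_add_smul i y t 0
  rw [this]
  fun_prop

/-- The insertion of the `i`-th coordinate `0`, as a linear isometry. -/
noncomputable def insertCoordIsometry (i : Fin (m + 1)) : E m →ₗᵢ[ℝ] E (m + 1) where
  toFun y := coordLine i y 0
  map_add' y y' := by
    ext k
    induction k using i.succAboveCases <;> simp
  map_smul' a y := by
    ext k
    induction k using i.succAboveCases <;> simp
  norm_map' y := by
    simp [EuclideanSpace.norm_eq, Fin.sum_univ_succAbove _ i]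

/-- The splitting of `ℝ^(m+1)` into the `i`-th coordinate and the remaining ones. -/
noncomputable def splitCoord (i : Fin (m + 1)) : E (m + 1) ≃ᵐ ℝ × E m :=
  ((MeasurableEquiv.toLp 2 (Fin (m + 1) → ℝ)).symm.trans
    (MeasurableEquiv.piFinSuccAbove (fun _ => ℝ) i)).trans
    ((MeasurableEquiv.refl ℝ).prodCongr (MeasurableEquiv.toLp 2 (Fin m → ℝ)))

theorem measurePreserving_splitCoord (i : Fin (m + 1)) :
    MeasurePreserving (splitCoord i) volume (volume.prod volume) :=
  ((PiLp.volume_preserving_ofLp (Fin (m + 1))).trans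
    (volume_preserving_piFinSuccAbove (fun _ : Fin (m + 1) => ℝ) i)).trans
    ((MeasurePreserving.id volume).prod (PiLp.volume_preserving_toLp (Fin m)))

theorem splitCoord_symm_apply (i : Fin (m + 1)) (t : ℝ) (y : E m) :
    (splitCoord i).symm (t, y) = coordLine i y t := by
  rw [MeasurableEquiv.symm_apply_eq]
  have h : ∀ x, splitCoord i x = (x i, dropCoord i x) := fun x => rfl
  simp [h]

theorem integral_eq_integral_coordLine (i : Fin (m + 1)) {g : E (m + 1) → ℝ}
    (hg : Integrable g) : ∫ x, g x = ∫ y, ∫ t, g (coordLine i y t) := by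
  have h := (measurePreserving_splitCoord i).symm
  rw [← h.integral_comp (splitCoord i).symm.measurableEmbedding]
  have hint : Integrable (fun w => g ((splitCoord i).symm w))
      ((volume : Measure ℝ).prod (volume : Measure (E m))) :=
    (h.integrable_comp_emb (splitCoord i).symm.measurableEmbedding).2 hg
  rw [integral_prod_symm _ hint]
  simp only [splitCoord_symm_apply]

/-- A linear isometry `L` of `ℝ^m` onto the hyperplane with unit normal `n`, followed by the
projection along the `i`-th axis, has determinant `± n i`: it is a minor of the orthogonal matrix
with columns `n` and `L e₁, …, L e_m`, hence, up to sign, an entry of its inverse. -/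
theorem abs_det_dropCoord_comp (L : E m →ₗᵢ[ℝ] E (m + 1)) {n : E (m + 1)} (hn : ‖n‖ = 1)
    (hL : ∀ u, inner ℝ (L u) n = 0) (i : Fin (m + 1)) :
    |LinearMap.det (dropCoord i ∘ₗ L.toLinearMap)| = |n i| := by
  let cols : Fin (m + 1) → E (m + 1) :=
    Fin.cons n fun k => L (EuclideanSpace.single k 1)
  let O : Matrix (Fin (m + 1)) (Fin (m + 1)) ℝ := Matrix.of fun r c => cols c r
  have hO : O.transpose * O = 1 := by
    ext a b
    have h1 : (O.transpose * O) a b = inner ℝ (cols b) (cols a) := by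
      simp [Matrix.mul_apply, O, PiLp.inner_apply]
    rw [h1]
    induction a using Fin.cases with
    | zero =>
      induction b using Fin.cases with
      | zero => simp [cols, hn]
      | succ b => simp [cols, hL, (Fin.succ_ne_zero b).symm]
    | succ a =>
      induction b using Fin.cases with
      | zero => simpa [cols] using (real_inner_comm _ _).trans (hL (EuclideanSpace.single a 1))
      | succ b =>
        simp [cols, L.inner_map_map, EuclideanSpace.inner_single_left, Matrix.one_apply,
          eq_comm]
  have hdet : |O.det| = 1 := by
    have := congrArg Matrix.det hO
    rw [Matrix.det_mul, Matrix.det_transpose, Matrix.det_one] at this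
    exact abs_eq_abs.2 (by simpa using mul_self_eq_one_iff.1 this) |>.trans abs_one
  have hadj : O.adjugate = O.det • O.transpose := by
    have h2 : O.transpose * (O * O.adjugate) = O.adjugate := by
      rw [← Matrix.mul_assoc, hO, Matrix.one_mul]
    rw [← h2, Matrix.mul_adjugate]
    simp
  have hent := congrFun (congrFun hadj 0) i
  rw [Matrix.adjugate_fin_succ_eq_det_submatrix] at hent
  have hsub : LinearMap.det (dropCoord i ∘ₗ L.toLinearMap) =
      (O.submatrix i.succAbove (0 : Fin (m + 1)).succAbove).det := by
    rw [← LinearMap.det_toMatrix (EuclideanSpace.basisFun (Fin m) ℝ).toBasis]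
    congr 1
  rw [hsub]
  have := congrArg abs hent
  rw [abs_mul, abs_pow, abs_neg, abs_one, one_pow, one_mul] at this
  rw [this, Matrix.smul_apply, smul_eq_mul, abs_mul, hdet, one_mul]
  rfl

end Coordinates

/-! ### The divergence theorem on a polytope -/

section Divergence

variable {m : ℕ}

/-- The boundary of `T ⊆ ℝ^(m+1)` as a union of non-overlapping flat faces: each face `e ∈ F` is
the image of the polytope `dom e` of `ℝ^m` under the affine isometry `chart e`, and has the outward
normal `normal e`. -/
structure ElementFaces (T : Set (E (m + 1))) (F : Finset (Set (E (m + 1)))) where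
  chart : Set (E (m + 1)) → E m →ᵃⁱ[ℝ] E (m + 1)
  dom : Set (E (m + 1)) → Set (E m)
  normal : Set (E (m + 1)) → E (m + 1)
  isPolytope : ∀ e ∈ F, IsPolytope (dom e)
  image_eq : ∀ e ∈ F, chart e '' dom e = e
  isOutwardNormal : ∀ e ∈ F, IsOutwardNormal T e (normal e)
  null_inter : ∀ e ∈ F, ∀ e' ∈ F, e ≠ e' → μHE[m] (e ∩ e') = 0
  frontier_eq : frontier T = ⋃ e ∈ F, e

theorem setIntegral_image_isometry (f : E m →ᵃⁱ[ℝ] E (m + 1)) (P : Set (E m))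
    (g : E (m + 1) → ℝ) : ∫ x in f '' P, g x ∂μHE[m] = ∫ u in P, g (f u) := by
  have hemb : MeasurableEmbedding f := f.isometry.isClosedEmbedding.measurableEmbedding
  have h := hemb.setIntegral_map (μ := (μHE[m] : Measure (E m))) g (f '' P)
  rw [f.isometry.map_euclideanHausdorffMeasure, Set.preimage_image_eq _ f.injective,
    EuclideanSpace.euclideanHausdorffMeasure_eq_volume, Measure.restrict_restrict_of_subset] at h
  · exact h
  · exact Set.image_subset_range _ _

variable {T : Set (E (m + 1))} {F : Finset (Set (E (m + 1)))}

namespace ElementFaces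

theorem isCompact_face (D : ElementFaces T F) {e : Set (E (m + 1))} (he : e ∈ F) :
    IsCompact e := by
  rw [← D.image_eq e he]
  exact (D.isPolytope e he).isCompact.image (D.chart e).continuous

theorem chart_mem (D : ElementFaces T F) {e : Set (E (m + 1))} (he : e ∈ F) {u : E m}
    (hu : u ∈ D.dom e) : D.chart e u ∈ e :=
  (D.image_eq e he).subset (Set.mem_image_of_mem _ hu)

theorem inner_linear_normal (D : ElementFaces T F) {e : Set (E (m + 1))} (he : e ∈ F) (u : E m) :
    inner ℝ ((D.chart e).linearIsometry u) (D.normal e) = 0 := by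
  -- `u` is a multiple of the difference of two points of the open set `interior (dom e)`.
  obtain ⟨u₀, hu₀⟩ := (D.isPolytope e he).isConnected_interior.nonempty
  have hlim : Tendsto (fun t : ℝ => u₀ + t • u) (𝓝[>] 0) (𝓝 u₀) := by
    have : Continuous fun t : ℝ => u₀ + t • u := by fun_prop
    simpa using (this.tendsto 0).mono_left nhdsWithin_le_nhds
  obtain ⟨t, ht, ht0⟩ := ((hlim.eventually (isOpen_interior.mem_nhds hu₀)).and
    self_mem_nhdsWithin).exists
  have hmem : ∀ w ∈ interior (D.dom e), D.chart e w ∈ e := fun w hw =>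
    D.chart_mem he (interior_subset hw)
  have h := (D.isOutwardNormal e he).orthogonal _ (hmem _ ht) _ (hmem _ hu₀)
  have h1 : D.chart e (u₀ + t • u) - D.chart e u₀ = t • (D.chart e).linearIsometry u := by
    have := (D.chart e).map_vsub (u₀ + t • u) u₀
    rw [vsub_eq_sub, vsub_eq_sub, add_sub_cancel_left, map_smul] at this
    exact this.symm
  rw [h1, inner_smul_left] at h
  exact (mul_eq_zero.1 h).resolve_left (by simpa using (Set.mem_Ioi.1 ht0).ne')

/-- Near a point of a single face at which the normal is outward, `T` is a half-space up to
points of the face: neither half of a small ball meets the boundary. -/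
theorem eventually_mem_iff_side (D : ElementFaces T F) (hT : IsPolytope T)
    {e : Set (E (m + 1))} (he : e ∈ F) {x : E (m + 1)} (hx : x ∈ e)
    (hx' : ∀ e' ∈ F, e' ≠ e → x ∉ e')
    (hout : ∀ᶠ t : ℝ in 𝓝[>] 0, x - t • D.normal e ∈ interior T ∧ x + t • D.normal e ∉ T) :
    ∀ᶠ y in 𝓝 x, (inner ℝ (y - x) (D.normal e) < 0 → y ∈ T) ∧
      (0 < inner ℝ (y - x) (D.normal e) → y ∉ T) := by
  have hn := (D.isOutwardNormal e he).norm_eq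
  have hU : ∀ᶠ y in 𝓝 x, ∀ e' ∈ F, e' ≠ e → y ∉ e' := by
    refine (Finset.eventually_all F).2 fun e' he' => ?_
    by_cases h : e' = e
    · exact Eventually.of_forall fun y h' => absurd h h'
    · filter_upwards [(D.isCompact_face he').isClosed.isOpen_compl.mem_nhds (hx' e' he' h)]
        with y hy _ using hy
  obtain ⟨ε, hε, hball⟩ := Metric.eventually_nhds_iff_ball.1 hU
  have hfr : ∀ y ∈ Metric.ball x ε, inner ℝ (y - x) (D.normal e) ≠ 0 → y ∉ frontier T := by
    intro y hy hne hyf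
    rw [D.frontier_eq] at hyf
    obtain ⟨e', he', hye'⟩ := Set.mem_iUnion₂.1 hyf
    by_cases h : e' = e
    · subst h
      exact hne ((D.isOutwardNormal e' he).orthogonal y hye' x hx)
    · exact hball y hy e' he' h hye'
  have hcover : ∀ y ∈ Metric.ball x ε, inner ℝ (y - x) (D.normal e) ≠ 0 →
      y ∈ interior T ∪ Tᶜ := by
    intro y hy hne
    by_cases hyT : y ∈ T
    · left
      by_contra h
      exact hfr y hy hne (by
        rw [hT.isCompact.isClosed.frontier_eq]
        exact ⟨hyT, h⟩)
    · exact Or.inr hyT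
  have hdisj : Disjoint (interior T) Tᶜ :=
    Set.disjoint_compl_right_iff_subset.2 interior_subset
  have hlin : ∀ y, inner ℝ (y - x) (D.normal e) =
      innerSL ℝ (D.normal e) y - innerSL ℝ (D.normal e) x := fun y => by
    rw [innerSL_apply_apply, innerSL_apply_apply, ← inner_sub_right, real_inner_comm]
  have hconv₁ : Convex ℝ (Metric.ball x ε ∩ {y | inner ℝ (y - x) (D.normal e) < 0}) := by
    refine (convex_ball x ε).inter ?_
    simp only [hlin, sub_neg]
    exact convex_halfSpace_lt (innerSL ℝ (D.normal e)).isLinear _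
  have hconv₂ : Convex ℝ (Metric.ball x ε ∩ {y | 0 < inner ℝ (y - x) (D.normal e)}) := by
    refine (convex_ball x ε).inter ?_
    simp only [hlin, sub_pos]
    exact convex_halfSpace_gt (innerSL ℝ (D.normal e)).isLinear _
  obtain ⟨t, ⟨ht1, ht2⟩, ht0, htε⟩ := (hout.and (Ioo_mem_nhdsGT hε)).exists
  have hnn : inner ℝ (D.normal e) (D.normal e) = (1 : ℝ) := by
    rw [real_inner_self_eq_norm_sq, hn, one_pow]
  have hm₁ : x - t • D.normal e ∈
      Metric.ball x ε ∩ {y | inner ℝ (y - x) (D.normal e) < 0} := by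
    refine ⟨?_, ?_⟩
    · simpa [mem_ball_iff_norm, norm_smul, hn, abs_of_pos ht0] using htε
    · have : x - t • D.normal e - x = -(t • D.normal e) := by abel
      simp only [Set.mem_ofPred_eq, this, inner_neg_left, inner_smul_left, hnn]
      simpa using ht0
  have hm₂ : x + t • D.normal e ∈
      Metric.ball x ε ∩ {y | 0 < inner ℝ (y - x) (D.normal e)} := by
    refine ⟨?_, ?_⟩
    · simpa [mem_ball_iff_norm, norm_smul, hn, abs_of_pos ht0] using htε
    · simp only [Set.mem_ofPred_eq, add_sub_cancel_left, inner_smul_left, hnn]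
      simpa using ht0
  have h₁ := hconv₁.isPreconnected.subset_left_of_subset_union isOpen_interior
    hT.isCompact.isClosed.isOpen_compl hdisj (fun y hy => hcover y hy.1 hy.2.ne)
    ⟨_, hm₁, ht1⟩
  have h₂ := hconv₂.isPreconnected.subset_right_of_subset_union isOpen_interior
    hT.isCompact.isClosed.isOpen_compl hdisj (fun y hy => hcover y hy.1 hy.2.ne')
    ⟨_, hm₂, ht2⟩
  filter_upwards [Metric.ball_mem_nhds x hε] with y hy
  exact ⟨fun h => interior_subset (h₁ ⟨hy, h⟩), fun h => h₂ ⟨hy, h⟩⟩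

theorem ae_not_mem_other_face_and_outward (D : ElementFaces T F) {e : Set (E (m + 1))} (he : e ∈ F) :
    ∀ᵐ u ∂(volume.restrict (D.dom e)),
      (∀ e' ∈ F, e' ≠ e → D.chart e u ∉ e') ∧
      ∀ᶠ t : ℝ in 𝓝[>] 0, D.chart e u - t • D.normal e ∈ interior T ∧
        D.chart e u + t • D.normal e ∉ T := by
  have hpull : ∀ N : Set (E (m + 1)), μHE[m] N = 0 → volume (D.chart e ⁻¹' N) = 0 := fun N hN => by
    have h := (D.chart e).isometry.euclideanHausdorffMeasure_preimage (d := m) N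
    rw [EuclideanSpace.euclideanHausdorffMeasure_eq_volume] at h
    rw [h]
    exact measure_mono_null Set.inter_subset_left hN
  have hPm : MeasurableSet (D.dom e) := (D.isPolytope e he).isCompact.measurableSet
  refine Eventually.and ?_ ?_
  · refine (Finset.eventually_all F).2 fun e' he' => ?_
    by_cases h : e' = e
    · exact Eventually.of_forall fun y h' => absurd h h'
    · rw [ae_restrict_iff' hPm]
      filter_upwards [compl_mem_ae_iff.2
        (hpull _ (D.null_inter e he e' he' (Ne.symm h)))] with u hu huP _ hue'
      exact hu ⟨D.chart_mem he huP, hue'⟩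
  · have hout := (D.isOutwardNormal e he).outward
    rw [ae_restrict_iff' (D.isCompact_face he).measurableSet] at hout
    rw [ae_restrict_iff' hPm]
    filter_upwards [compl_mem_ae_iff.2 (hpull _ hout)] with u hu huP
    by_contra hcon
    exact hu fun h => hcon (h (D.chart_mem he huP))

/-- The projection of the face `e` along the `i`-th axis, in the coordinates of `chart e`. -/
noncomputable def shadow (D : ElementFaces T F) (i : Fin (m + 1)) (e : Set (E (m + 1)))
    (u : E m) : E m :=
  dropCoord i (D.chart e u)

/-- The linear part of `shadow`. -/
noncomputable def shadowLinear (D : ElementFaces T F) (i : Fin (m + 1)) (e : Set (E (m + 1))) :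
    E m →ₗ[ℝ] E m :=
  dropCoord i ∘ₗ (D.chart e).linearIsometry.toLinearMap

theorem shadow_eq (D : ElementFaces T F) (i : Fin (m + 1)) (e : Set (E (m + 1))) (u : E m) :
    D.shadow i e u = D.shadow i e 0 + D.shadowLinear i e u := by
  have h : D.chart e u = (D.chart e).linearIsometry u + D.chart e 0 := by
    simpa using (D.chart e).map_vadd 0 u
  simp [shadow, shadowLinear, h, add_comm]

theorem abs_det_shadowLinear (D : ElementFaces T F) (i : Fin (m + 1)) {e : Set (E (m + 1))}
    (he : e ∈ F) : |LinearMap.det (D.shadowLinear i e)| = |D.normal e i| :=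
  abs_det_dropCoord_comp _ (D.isOutwardNormal e he).norm_eq (D.inner_linear_normal he) i

theorem volume_shadow_image (D : ElementFaces T F) (i : Fin (m + 1)) {e : Set (E (m + 1))}
    (he : e ∈ F) (s : Set (E m)) :
    volume (D.shadow i e '' s) = ENNReal.ofReal |D.normal e i| * volume s := by
  have h : D.shadow i e '' s =
      (fun y => D.shadow i e 0 + y) '' (D.shadowLinear i e '' s) := by
    rw [Set.image_image]
    exact Set.image_congr fun u _ => D.shadow_eq i e u
  rw [h, Set.image_add_left, measure_preimage_add, Measure.addHaar_image_linearMap,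
    D.abs_det_shadowLinear i he]

theorem shadow_injective (D : ElementFaces T F) (i : Fin (m + 1)) {e : Set (E (m + 1))}
    (he : e ∈ F) (hi : D.normal e i ≠ 0) : Function.Injective (D.shadow i e) := by
  have hdet : LinearMap.det (D.shadowLinear i e) ≠ 0 := by
    rw [← abs_pos, D.abs_det_shadowLinear i he]
    exact abs_pos.2 hi
  have hinj : Function.Injective (D.shadowLinear i e) :=
    (LinearMap.equivOfDetNeZero _ hdet).injective
  intro u v huv
  rw [D.shadow_eq i e u, D.shadow_eq i e v] at huv
  exact hinj (add_left_cancel huv)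

theorem hasFDerivAt_shadow (D : ElementFaces T F) (i : Fin (m + 1)) (e : Set (E (m + 1)))
    (u : E m) :
    HasFDerivAt (D.shadow i e) (LinearMap.toContinuousLinearMap (D.shadowLinear i e)) u := by
  have h : D.shadow i e = fun u =>
      D.shadow i e 0 + LinearMap.toContinuousLinearMap (D.shadowLinear i e) u :=
    funext fun u => D.shadow_eq i e u
  rw [h]
  exact (ContinuousLinearMap.hasFDerivAt _).const_add _

/-- The contribution of the face `e` to the integral over the line in direction `i` through `y`:
the value of `g` at the point of `e` over `y`, signed by the direction in which the line leaves
`T` there. -/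
noncomputable def lineTerm (D : ElementFaces T F) (i : Fin (m + 1)) (g : E (m + 1) → ℝ)
    (e : Set (E (m + 1))) : E m → ℝ :=
  (D.shadow i e '' D.dom e).indicator fun y =>
    SignType.sign (D.normal e i) * g (D.chart e (Function.invFun (D.shadow i e) y))

theorem measurableSet_shadow_image (D : ElementFaces T F) (i : Fin (m + 1))
    {e : Set (E (m + 1))} (he : e ∈ F) : MeasurableSet (D.shadow i e '' D.dom e) := by
  refine ((D.isPolytope e he).isCompact.image ?_).measurableSet
  exact continuous_iff_continuousAt.2 fun u => (D.hasFDerivAt_shadow i e u).continuousAt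

theorem integrableOn_shadow_image (D : ElementFaces T F) (i : Fin (m + 1)) {g : E (m + 1) → ℝ}
    (hg : Continuous g) {e : Set (E (m + 1))} (he : e ∈ F) (hi : D.normal e i ≠ 0) :
    IntegrableOn (fun y => SignType.sign (D.normal e i) *
      g (D.chart e (Function.invFun (D.shadow i e) y))) (D.shadow i e '' D.dom e) := by
  have hinj := D.shadow_injective i he hi
  rw [integrableOn_image_iff_integrableOn_abs_det_fderiv_smul volume
    (D.isPolytope e he).isCompact.measurableSet
    (fun u _ => (D.hasFDerivAt_shadow i e u).hasFDerivWithinAt) hinj.injOn]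
  simp only [Function.leftInverse_invFun hinj _]
  refine IsPolytope.integrableOn (D.isPolytope e he) ?_
  have := (D.chart e).continuous
  fun_prop

theorem integrable_lineTerm (D : ElementFaces T F) (i : Fin (m + 1)) {g : E (m + 1) → ℝ}
    (hg : Continuous g) {e : Set (E (m + 1))} (he : e ∈ F) (hi : D.normal e i ≠ 0) :
    Integrable (D.lineTerm i g e) :=
  (integrable_indicator_iff (D.measurableSet_shadow_image i he)).2
    (D.integrableOn_shadow_image i hg he hi)

theorem integral_lineTerm (D : ElementFaces T F) (i : Fin (m + 1)) (g : E (m + 1) → ℝ)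
    {e : Set (E (m + 1))} (he : e ∈ F) (hi : D.normal e i ≠ 0) :
    ∫ y, D.lineTerm i g e y = D.normal e i * ∫ x in e, g x ∂μHE[m] := by
  have hinj := D.shadow_injective i he hi
  rw [lineTerm, integral_indicator (D.measurableSet_shadow_image i he),
    integral_image_eq_integral_abs_det_fderiv_smul volume
      (D.isPolytope e he).isCompact.measurableSet
      (fun u _ => (D.hasFDerivAt_shadow i e u).hasFDerivWithinAt) hinj.injOn]
  have hface : ∫ x in e, g x ∂μHE[m] = ∫ u in D.dom e, g (D.chart e u) := by
    rw [← setIntegral_image_isometry, D.image_eq e he]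
  rw [hface, ← integral_const_mul]
  refine integral_congr_ae (Eventually.of_forall fun u => ?_)
  have hdet : |(LinearMap.toContinuousLinearMap (D.shadowLinear i e)).det| = |D.normal e i| :=
    D.abs_det_shadowLinear i he
  simp only [Function.leftInverse_invFun hinj u, hdet, smul_eq_mul]
  rw [← mul_assoc, abs_mul_sign]

/-- The points `y` for which the line in direction `i` over `y` crosses the boundary of `T` only at
points of a single face, transversally and along its outward normal. -/
def IsRegularLine (D : ElementFaces T F) (i : Fin (m + 1)) (y : E m) : Prop :=
  ∀ e ∈ F, ∀ u ∈ D.dom e, D.shadow i e u = y → D.normal e i ≠ 0 ∧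
    (∀ e' ∈ F, e' ≠ e → D.chart e u ∉ e') ∧
    ∀ᶠ t : ℝ in 𝓝[>] 0, D.chart e u - t • D.normal e ∈ interior T ∧
      D.chart e u + t • D.normal e ∉ T

theorem ae_isRegularLine (D : ElementFaces T F) (i : Fin (m + 1)) :
    ∀ᵐ y : E m, D.IsRegularLine i y := by
  refine (Finset.eventually_all F).2 fun e he => ?_
  let N : Set (E m) := {u | u ∈ D.dom e ∧ ¬ (D.normal e i ≠ 0 ∧
    (∀ e' ∈ F, e' ≠ e → D.chart e u ∉ e') ∧
    ∀ᶠ t : ℝ in 𝓝[>] 0, D.chart e u - t • D.normal e ∈ interior T ∧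
      D.chart e u + t • D.normal e ∉ T)}
  have hN : volume (D.shadow i e '' N) = 0 := by
    rw [D.volume_shadow_image i he]
    by_cases hi : D.normal e i = 0
    · simp [hi]
    · have h := D.ae_not_mem_other_face_and_outward he
      rw [ae_restrict_iff' (D.isPolytope e he).isCompact.measurableSet] at h
      have : volume N = 0 := measure_mono_null
        (fun u hu (h' : u ∈ D.dom e → _) => hu.2 ⟨hi, h' hu.1⟩) h
      rw [this, mul_zero]
  filter_upwards [compl_mem_ae_iff.2 hN] with y hy u hu huy
  by_contra hcon
  exact hy ⟨u, ⟨hu, hcon⟩, huy⟩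

theorem setIntegral_coordLine_eq_sum (D : ElementFaces T F) (hT : IsPolytope T)
    (i : Fin (m + 1)) (p : Poly (m + 1)) {y : E m} (hy : D.IsRegularLine i y) :
    ∫ t, T.indicator (pev (MvPolynomial.pderiv i p)) (coordLine i y t) =
      ∑ e ∈ F with D.normal e i ≠ 0, D.lineTerm i (pev p) e y := by
  let S : Set ℝ := coordLine i y ⁻¹' T
  have hcl := continuous_coordLine i y
  have hSclosed : IsClosed S := hT.isCompact.isClosed.preimage hcl
  have hS : IsCompact S := by
    refine Metric.isCompact_of_isClosed_isBounded hSclosed ?_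
    have hb := (hT.isCompact.image (f := fun x : E (m + 1) => x i) (by fun_prop)).isBounded
    refine hb.subset fun t ht => ⟨_, ht, by simp⟩
  let J : Finset (Set (E (m + 1))) :=
    F.filter fun e => D.normal e i ≠ 0 ∧ y ∈ D.shadow i e '' D.dom e
  let z : Set (E (m + 1)) → ℝ := fun e => D.chart e (Function.invFun (D.shadow i e) y) i
  let s : Set (E (m + 1)) → ℝ := fun e => SignType.sign (D.normal e i)
  have hcross : ∀ e ∈ F, ∀ t, coordLine i y t ∈ e → e ∈ J ∧ t = z e := by
    intro e he t ht
    obtain ⟨u, hu, hut⟩ := (D.image_eq e he).superset ht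
    have huy : D.shadow i e u = y := by rw [shadow, hut, dropCoord_coordLine]
    have hi := (hy e he u hu huy).1
    refine ⟨Finset.mem_filter.2 ⟨he, hi, u, hu, huy⟩, ?_⟩
    have hinv : Function.invFun (D.shadow i e) y = u := by
      rw [← huy]
      exact Function.leftInverse_invFun (D.shadow_injective i he hi) u
    simp only [z, hinv, hut, coordLine_apply_same]
  have hpoint : ∀ e ∈ J, Function.invFun (D.shadow i e) y ∈ D.dom e ∧
      D.shadow i e (Function.invFun (D.shadow i e) y) = y ∧
      D.chart e (Function.invFun (D.shadow i e) y) = coordLine i y (z e) := by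
    intro e heJ
    obtain ⟨he, hi, u, hu, huy⟩ := Finset.mem_filter.1 heJ
    have hinv : Function.invFun (D.shadow i e) y = u := by
      rw [← huy]
      exact Function.leftInverse_invFun (D.shadow_injective i he hi) u
    rw [hinv]
    refine ⟨hu, huy, ?_⟩
    have := coordLine_dropCoord i (D.chart e u)
    rw [show dropCoord i (D.chart e u) = y from huy] at this
    simp only [z, hinv, this]
  have key := setIntegral_deriv_eq_sum_jumps J z s ?_ hS ?_ ?_
    (G := fun t => pev p (coordLine i y t))
    (G' := fun t => pev (MvPolynomial.pderiv i p) (coordLine i y t)) ?_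
    ((continuous_pev _).comp hcl)
  · rw [← integral_indicator hSclosed.measurableSet] at key
    refine Eq.trans (integral_congr_ae (Eventually.of_forall fun t => ?_)) (key.trans ?_)
    · by_cases h : coordLine i y t ∈ T
      · have h' : t ∈ S := h
        simp [h, h']
      · have h' : t ∉ S := h
        simp [h, h']
    · have hJ : J = (F.filter fun e => D.normal e i ≠ 0).filter
          fun e => y ∈ D.shadow i e '' D.dom e := by
        rw [Finset.filter_filter]
      rw [hJ, Finset.sum_filter]
      refine Finset.sum_congr rfl fun e he => ?_
      rw [lineTerm, Set.indicator_apply]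
      split_ifs with h
      · have heJ : e ∈ J := by
          rw [hJ]
          exact Finset.mem_filter.2 ⟨he, h⟩
        rw [(hpoint e heJ).2.2]
      · rfl
  · intro e he e' he' hzz
    by_contra hne
    obtain ⟨hu, huy, hc⟩ := hpoint e he
    obtain ⟨hu', huy', hc'⟩ := hpoint e' he'
    refine (hy e (Finset.mem_filter.1 he).1 _ hu huy).2.1 e' (Finset.mem_filter.1 he').1
      (Ne.symm hne) ?_
    rw [hc, hzz, ← hc']
    exact D.chart_mem (Finset.mem_filter.1 he').1 hu'
  · intro t ht
    have hfr : coordLine i y t ∉ frontier T := by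
      rw [D.frontier_eq]
      intro h
      obtain ⟨e, he, hte⟩ := Set.mem_iUnion₂.1 h
      obtain ⟨heJ, hz⟩ := hcross e he t hte
      exact ht e heJ hz
    by_cases hmem : coordLine i y t ∈ T
    · left
      have hint : coordLine i y t ∈ interior T := by
        by_contra h
        exact hfr (by
          rw [hT.isCompact.isClosed.frontier_eq]
          exact ⟨hmem, h⟩)
      filter_upwards [hcl.continuousAt.eventually (isOpen_interior.mem_nhds hint)] with t' ht'
      exact (interior_subset ht' : coordLine i y t' ∈ T)
    · right
      exact hSclosed.isOpen_compl.mem_nhds hmem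
  · intro e heJ
    obtain ⟨he, hi, -⟩ := Finset.mem_filter.1 heJ
    obtain ⟨hu, huy, hc⟩ := hpoint e heJ
    obtain ⟨-, h1, h2⟩ := hy e he _ hu huy
    have hside := D.eventually_mem_iff_side hT he (D.chart_mem he hu) h1 h2
    rw [hc] at hside
    have hside' := hcl.continuousAt.eventually hside
    have hin : ∀ t, inner ℝ (coordLine i y t - coordLine i y (z e)) (D.normal e) =
        (t - z e) * D.normal e i := fun t => by
      rw [coordLine_eq_add_smul i y t (z e), add_sub_cancel_left, inner_smul_left,
        EuclideanSpace.inner_single_left]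
      simp
    simp only [hin] at hside'
    rcases lt_or_gt_of_ne hi with hneg | hpos
    · refine Or.inr ⟨by simp [s, hneg], ?_, ?_⟩
      · filter_upwards [self_mem_nhdsWithin, hside'.filter_mono nhdsWithin_le_nhds] with t ht hs
        exact hs.2 (mul_pos_of_neg_of_neg (sub_neg.2 ht) hneg)
      · filter_upwards [self_mem_nhdsWithin, hside'.filter_mono nhdsWithin_le_nhds] with t ht hs
        exact hs.1 (mul_neg_of_pos_of_neg (sub_pos.2 ht) hneg)
    · refine Or.inl ⟨by simp [s, hpos], ?_, ?_⟩
      · filter_upwards [self_mem_nhdsWithin, hside'.filter_mono nhdsWithin_le_nhds] with t ht hs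
        exact hs.1 (mul_neg_of_neg_of_pos (sub_neg.2 ht) hpos)
      · filter_upwards [self_mem_nhdsWithin, hside'.filter_mono nhdsWithin_le_nhds] with t ht hs
        exact hs.2 (mul_pos (sub_pos.2 ht) hpos)
  · intro t
    have h := hasDerivAt_pev_line p (coordLine i y 0) i t
    have hline : ∀ t, coordLine i y 0 + t • EuclideanSpace.single i (1 : ℝ) = coordLine i y t :=
      fun t => by
        rw [coordLine_eq_add_smul i y t 0, sub_zero]
    simpa only [hline] using h

/-- The divergence theorem on a polytope, for a polynomial and the `i`-th partial derivative:
by Fubini along the `i`-th axis, both sides are integrals over the lines in that direction, almost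
all of which cross the boundary regularly. -/
theorem setIntegral_pderiv (D : ElementFaces T F) (hT : IsPolytope T) (i : Fin (m + 1))
    (p : Poly (m + 1)) :
    ∫ x in T, pev (MvPolynomial.pderiv i p) x =
      ∑ e ∈ F, D.normal e i * ∫ x in e, pev p x ∂μHE[m] := by
  have hTm : MeasurableSet T := hT.isCompact.measurableSet
  rw [← integral_indicator hTm, integral_eq_integral_coordLine i
    ((integrable_indicator_iff hTm).2 (hT.integrableOn (continuous_pev _)))]
  rw [integral_congr_ae ((D.ae_isRegularLine i).mono fun y hy =>
    D.setIntegral_coordLine_eq_sum hT i p hy)]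
  rw [integral_finsetSum _ fun e he => D.integrable_lineTerm i (continuous_pev p)
    (Finset.mem_filter.1 he).1 (Finset.mem_filter.1 he).2]
  rw [Finset.sum_congr rfl fun e he => D.integral_lineTerm i (pev p)
    (Finset.mem_filter.1 he).1 (Finset.mem_filter.1 he).2]
  refine Finset.sum_filter_of_ne fun e _ h hi => h ?_
  rw [hi, zero_mul]

end ElementFaces

end Divergence

/-! ### Regular elements and bubble functions -/

section Regular

theorem setIntegral_le_mul_measureReal {α : Type*} [MeasurableSpace α] {μ : Measure α} {s : Set α}
    (hs : MeasurableSet s) (hμ : μ s ≠ ⊤) {f : α → ℝ} {C : ℝ} (hf : IntegrableOn f s μ)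
    (h : ∀ x ∈ s, f x ≤ C) : ∫ x in s, f x ∂μ ≤ C * μ.real s := by
  refine (setIntegral_mono_on hf (integrableOn_const hμ) hs h).trans ?_
  rw [setIntegral_const, smul_eq_mul, mul_comm]

/-- The `L²` form of `exists_weighted_sq_le_setIntegral`: inserting the weights costs only a
constant factor. -/
theorem exists_setIntegral_sq_le_weighted (n r N : ℕ) {ϱ δ : ℝ} (hϱ : 0 < ϱ) (hδ : 0 < δ) :
    ∃ C : ℝ, 0 < C ∧ ∀ (x₀ : E n) (R : ℝ), 0 < R → ∀ A : Set (E n), MeasurableSet A →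
      A ⊆ Metric.closedBall x₀ R → ϱ * R ^ n ≤ volume.real A →
      ∀ (ι : Type) (J : Finset ι) (w : ι → Poly n), J.card ≤ N →
      (∀ j ∈ J, (w j).totalDegree ≤ 1) →
      (∀ j ∈ J, ∃ z ∈ Metric.closedBall x₀ R, δ ≤ |pev (w j) z|) →
      ∀ p : Poly n, p.totalDegree ≤ r →
        (∀ z ∈ Metric.closedBall x₀ R, R ^ n * pev p z ^ 2 ≤
          C * ∫ x in A, (∏ j ∈ J, pev (w j) x) ^ 2 * pev p x ^ 2) ∧
        ∫ x in A, pev p x ^ 2 ≤ C * ∫ x in A, (∏ j ∈ J, pev (w j) x) ^ 2 * pev p x ^ 2 := by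
  obtain ⟨c, hc, h⟩ := exists_weighted_sq_le_setIntegral n r N hϱ hδ
  let ω := volume.real (Metric.ball (0 : E n) 1)
  have hω : 0 ≤ ω := measureReal_nonneg
  refine ⟨(1 + ω) / c, by positivity, ?_⟩
  intro x₀ R hR A hA hAB hvol ι J w hJ hw hwδ p hp
  have h := h x₀ R hR A hA hAB hvol ι J w hJ hw hwδ p hp
  set I := ∫ x in A, (∏ j ∈ J, pev (w j) x) ^ 2 * pev p x ^ 2 with hI
  have hI0 : 0 ≤ I := integral_nonneg fun x => by positivity
  have hBc : IsCompact (Metric.closedBall x₀ R) := isCompact_closedBall _ _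
  refine ⟨fun z hz => ?_, ?_⟩
  · rw [div_mul_eq_mul_div, le_div_iff₀ hc]
    nlinarith [h z hz, mul_nonneg hω hI0]
  · have h1 : ∫ x in A, pev p x ^ 2 ≤ I / (c * R ^ n) * volume.real A := by
      refine setIntegral_le_mul_measureReal hA ((measure_mono hAB).trans_lt hBc.measure_lt_top).ne
        ((((continuous_pev p).pow 2).continuousOn.integrableOn_compact hBc).mono_set hAB)
        fun x hx => ?_
      rw [le_div_iff₀ (by positivity), mul_comm]
      exact h x (hAB hx)
    have h2 : volume.real A ≤ R ^ n * ω := by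
      refine (measureReal_mono hAB hBc.measure_lt_top.ne).trans ?_
      rw [Measure.addHaar_real_closedBall _ _ hR.le]
      simp [ω]
    calc _ ≤ I / (c * R ^ n) * (R ^ n * ω) := h1.trans (by gcongr)
      _ = ω / c * I := by field_simp
      _ ≤ (1 + ω) / c * I := by gcongr; linarith

variable {m : ℕ} {T : Set (E (m + 1))} {F : Finset (Set (E (m + 1)))}

namespace ElementFaces

/-- The signed height of `x` above the hyperplane of the face `e`. -/
noncomputable def height (D : ElementFaces T F) (e : Set (E (m + 1))) (x : E (m + 1)) : ℝ :=
  inner ℝ (x - D.chart e 0) (D.normal e)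

/-- `height` in units of `h`, as a polynomial. -/
noncomputable def heightPoly (D : ElementFaces T F) (h : ℝ) (e : Set (E (m + 1))) :
    Poly (m + 1) :=
  MvPolynomial.C h⁻¹ * ∑ i, MvPolynomial.C (D.normal e i) *
    (MvPolynomial.X i - MvPolynomial.C (D.chart e 0 i))

theorem pev_heightPoly (D : ElementFaces T F) (h : ℝ) (e : Set (E (m + 1))) (x : E (m + 1)) :
    pev (D.heightPoly h e) x = h⁻¹ * D.height e x := by
  simp [heightPoly, height, PiLp.inner_apply]

theorem totalDegree_heightPoly_le (D : ElementFaces T F) (h : ℝ) (e : Set (E (m + 1))) :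
    (D.heightPoly h e).totalDegree ≤ 1 := by
  refine (MvPolynomial.totalDegree_mul _ _).trans ?_
  rw [MvPolynomial.totalDegree_C, zero_add]
  refine MvPolynomial.totalDegree_finsetSum_le fun i _ => ?_
  refine (MvPolynomial.totalDegree_mul _ _).trans ?_
  rw [MvPolynomial.totalDegree_C, zero_add]
  exact (MvPolynomial.totalDegree_sub_C_le _ _).trans (by simp)

theorem height_chart (D : ElementFaces T F) {e : Set (E (m + 1))} (he : e ∈ F) (u : E m) :
    D.height e (D.chart e u) = 0 := by
  have h : D.chart e u - D.chart e 0 = (D.chart e).linearIsometry u := by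
    simpa using ((D.chart e).map_vsub u 0).symm
  rw [height, h, D.inner_linear_normal he]

theorem height_eq_zero (D : ElementFaces T F) {e : Set (E (m + 1))} (he : e ∈ F)
    {x : E (m + 1)} (hx : x ∈ e) : D.height e x = 0 := by
  obtain ⟨u, -, rfl⟩ := (D.image_eq e he).superset hx
  exact D.height_chart he u

theorem height_eq_inner (D : ElementFaces T F) {e : Set (E (m + 1))} (he : e ∈ F)
    {y : E (m + 1)} (hy : y ∈ e) (x : E (m + 1)) :
    D.height e x = inner ℝ (x - y) (D.normal e) := by
  have h := D.height_eq_zero he hy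
  have h2 : x - D.chart e 0 = (x - y) + (y - D.chart e 0) := by abel
  rw [height, h2, inner_add_left]
  rw [height] at h
  rw [h, add_zero]

theorem nonempty_dom (D : ElementFaces T F) {e : Set (E (m + 1))} (he : e ∈ F) :
    (D.dom e).Nonempty :=
  (D.isPolytope e he).isConnected_interior.nonempty.mono interior_subset

theorem nonempty_face (D : ElementFaces T F) {e : Set (E (m + 1))} (he : e ∈ F) : e.Nonempty :=
  let ⟨_, hu⟩ := D.nonempty_dom he
  ⟨_, D.chart_mem he hu⟩

theorem face_subset (D : ElementFaces T F) (hT : IsPolytope T) {e : Set (E (m + 1))}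
    (he : e ∈ F) : e ⊆ T := fun x hx =>
  hT.isCompact.isClosed.frontier_subset (by
    rw [D.frontier_eq]
    exact Set.mem_biUnion he hx)

theorem integrableOn_face (D : ElementFaces T F) {e : Set (E (m + 1))} (he : e ∈ F)
    {g : E (m + 1) → ℝ} (hg : Continuous g) : IntegrableOn g e μHE[m] :=
  IsFlatFace.integrableOn (d := m + 1) ⟨D.chart e, D.dom e, D.isPolytope e he,
    (D.image_eq e he).symm⟩ hg

theorem exists_chart_eq_of_inner_eq_zero (D : ElementFaces T F) {e : Set (E (m + 1))}
    (he : e ∈ F) {x : E (m + 1)} (hx : inner ℝ (x - D.chart e 0) (D.normal e) = 0) :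
    ∃ v, D.chart e v = x := by
  have hn := (D.isOutwardNormal e he).norm_eq
  have hn0 : D.normal e ≠ 0 := by
    intro h
    simp [h] at hn
  have hle : LinearMap.range (D.chart e).linearIsometry.toLinearMap ≤
      (Submodule.span ℝ {D.normal e})ᗮ := by
    rintro _ ⟨u, rfl⟩
    rw [Submodule.mem_orthogonal_singleton_iff_inner_left]
    exact D.inner_linear_normal he u
  have : Fact (Module.finrank ℝ (E (m + 1)) = m + 1) := ⟨by simp⟩
  have heq := Submodule.eq_of_le_of_finrank_eq hle (by
    rw [Submodule.finrank_orthogonal_span_singleton (n := m) hn0,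
      LinearMap.finrank_range_of_inj (D.chart e).linearIsometry.injective]
    simp)
  have hmem : x - D.chart e 0 ∈ (Submodule.span ℝ {D.normal e})ᗮ :=
    Submodule.mem_orthogonal_singleton_iff_inner_left.2 hx
  rw [← heq] at hmem
  obtain ⟨v, hv⟩ := hmem
  refine ⟨v, ?_⟩
  have h2 : D.chart e v = (D.chart e).linearIsometry v + D.chart e 0 := by
    simpa using (D.chart e).map_vadd 0 v
  rw [h2]
  exact (sub_eq_iff_eq_add.1 hv.symm).symm

/-- The foot of the perpendicular from `x` to the hyperplane of `e`. -/
theorem exists_chart_eq_foot (D : ElementFaces T F) {e : Set (E (m + 1))} (he : e ∈ F)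
    (x : E (m + 1)) : ∃ v, D.chart e v = x - D.height e x • D.normal e := by
  refine D.exists_chart_eq_of_inner_eq_zero he ?_
  have hn := (D.isOutwardNormal e he).norm_eq
  have h : x - D.height e x • D.normal e - D.chart e 0 =
      (x - D.chart e 0) - D.height e x • D.normal e := by abel
  rw [h, inner_sub_left, inner_smul_left, real_inner_self_eq_norm_sq, hn]
  simp [height]

theorem infDist_affineSpan_le_abs_height (D : ElementFaces T F) {e : Set (E (m + 1))}
    (he : e ∈ F) (x : E (m + 1)) :
    Metric.infDist x (affineSpan ℝ e : Set (E (m + 1))) ≤ |D.height e x| := by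
  obtain ⟨v, hv⟩ := D.exists_chart_eq_foot he x
  have htop : affineSpan ℝ (D.dom e) = ⊤ := top_le_iff.1 <|
    (isOpen_interior.affineSpan_eq_top (D.isPolytope e he).isConnected_interior.nonempty).ge.trans
      (affineSpan_mono ℝ interior_subset)
  have hmem : D.chart e v ∈ (affineSpan ℝ e : Set (E (m + 1))) := by
    have h := AffineSubspace.map_span (D.chart e).toAffineMap (D.dom e)
    rw [htop] at h
    have h2 : (D.chart e).toAffineMap '' D.dom e = e := D.image_eq e he
    rw [h2] at h
    rw [← h]
    exact ⟨v, trivial, rfl⟩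
  refine (Metric.infDist_le_dist_of_mem hmem).trans (le_of_eq ?_)
  rw [hv, dist_eq_norm, sub_sub_cancel, norm_smul, (D.isOutwardNormal e he).norm_eq, mul_one,
    Real.norm_eq_abs]

/-- A convex element lies below the hyperplane of each of its faces: a point above it would
put the points just outside some relatively interior point of the face into the element. -/
theorem height_nonpos_of_convex (D : ElementFaces T F) (hT : IsPolytope T) (hconv : Convex ℝ T)
    {e : Set (E (m + 1))} (he : e ∈ F) {y : E (m + 1)} (hy : y ∈ T) : D.height e y ≤ 0 := by
  by_contra! hpos
  -- A relatively interior point `chart e u` of `e` at which the normal is outward.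
  obtain ⟨u, hu, hout⟩ : ∃ u ∈ interior (D.dom e), ∀ᶠ t : ℝ in 𝓝[>] 0,
      D.chart e u - t • D.normal e ∈ interior T ∧ D.chart e u + t • D.normal e ∉ T := by
    by_contra hcon
    have h := ae_restrict_of_ae_restrict_of_subset interior_subset
      ((D.ae_not_mem_other_face_and_outward he).mono fun u h => h.2)
    rw [ae_restrict_iff' isOpen_interior.measurableSet] at h
    refine (isOpen_interior.measure_pos volume
      (D.isPolytope e he).isConnected_interior.nonempty).ne' ?_
    refine measure_mono_null (fun u hu => ?_) h
    change ¬ (u ∈ interior (D.dom e) → _)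
    exact fun h' => hcon ⟨u, hu, h' hu⟩
  set s := D.height e y with hs
  obtain ⟨v, hv⟩ := D.exists_chart_eq_foot he y
  have hlim : Tendsto (fun t : ℝ => u - t • (v - u)) (𝓝[>] 0) (𝓝 u) := by
    have : Continuous fun t : ℝ => u - t • (v - u) := by fun_prop
    simpa using (this.tendsto 0).mono_left nhdsWithin_le_nhds
  have hlim2 : Tendsto (fun t : ℝ => t / (1 + t) * s) (𝓝[>] 0) (𝓝[>] 0) := by
    refine tendsto_nhdsWithin_iff.2 ⟨?_, ?_⟩
    · have : ContinuousAt (fun t : ℝ => t / (1 + t) * s) 0 := by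
        refine ContinuousAt.mul (ContinuousAt.div continuousAt_id (by fun_prop) (by norm_num))
          continuousAt_const
      simpa using this.tendsto.mono_left nhdsWithin_le_nhds
    · filter_upwards [self_mem_nhdsWithin] with t ht
      have : 0 < t := ht
      exact Set.mem_Ioi.2 (by positivity)
  obtain ⟨t, ⟨htu, htout⟩, ht0⟩ := (((hlim.eventually (isOpen_interior.mem_nhds hu)).and
    (hlim2.eventually hout)).and self_mem_nhdsWithin).exists
  have ht0 : 0 < t := ht0
  refine htout.2 ?_
  have hw : D.chart e (u - t • (v - u)) ∈ T :=
    D.face_subset hT he (D.chart_mem he (interior_subset htu))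
  have hcomb := hconv hw hy (a := 1 / (1 + t)) (b := t / (1 + t)) (by positivity) (by positivity)
    (by field_simp)
  have hL : ∀ w, D.chart e w = (D.chart e).linearIsometry w + D.chart e 0 := fun w => by
    simpa using (D.chart e).map_vadd 0 w
  have hy' : y = D.chart e v + s • D.normal e := by rw [hv]; abel
  convert hcomb using 1
  rw [hy', hL u, hL v, hL (u - t • (v - u))]
  simp only [map_sub, map_smul]
  have h1 : (1 + t) ≠ 0 := by positivity
  ext i
  simp only [PiLp.add_apply, PiLp.smul_apply, PiLp.sub_apply, smul_eq_mul]
  field_simp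
  ring

/-- The part of shape regularity that is used on a single element of size `h`: neither the element
nor its faces are small, there are boundedly many faces, and no face lies near the hyperplane of
another one. -/
structure IsRegular (D : ElementFaces T F) (ϱ δ : ℝ) (N : ℕ) (h : ℝ) : Prop where
  pos : 0 < h
  isPolytope : IsPolytope T
  dist_le : ∀ x ∈ T, ∀ y ∈ T, dist x y ≤ h
  volume_ge : ϱ * h ^ (m + 1) ≤ volume.real T
  volume_dom_ge : ∀ e ∈ F, ϱ * h ^ m ≤ volume.real (D.dom e)
  card_le : F.card ≤ N
  exists_height_ge : ∀ e ∈ F, ∀ e' ∈ F, e ≠ e' →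
    ∃ u ∈ D.dom e, δ * h ≤ |D.height e' (D.chart e u)|

variable {D : ElementFaces T F} {ϱ δ h : ℝ} {N : ℕ}

namespace IsRegular

theorem nonempty (hD : D.IsRegular ϱ δ N h) : T.Nonempty :=
  hD.isPolytope.isConnected_interior.nonempty.mono interior_subset

theorem subset_closedBall (hD : D.IsRegular ϱ δ N h) {x₀ : E (m + 1)} (hx₀ : x₀ ∈ T) :
    T ⊆ Metric.closedBall x₀ h := fun x hx => hD.dist_le x hx x₀ hx₀

theorem dom_subset_closedBall (hD : D.IsRegular ϱ δ N h) {e : Set (E (m + 1))} (he : e ∈ F)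
    {u₀ : E m} (hu₀ : u₀ ∈ D.dom e) : D.dom e ⊆ Metric.closedBall u₀ h := fun u hu => by
  rw [Metric.mem_closedBall, ← (D.chart e).dist_map]
  exact hD.dist_le _ (D.face_subset hD.isPolytope he (D.chart_mem he hu)) _
    (D.face_subset hD.isPolytope he (D.chart_mem he hu₀))

theorem abs_heightPoly_le_one (hD : D.IsRegular ϱ δ N h) {e : Set (E (m + 1))} (he : e ∈ F)
    {x : E (m + 1)} (hx : x ∈ T) : |pev (D.heightPoly h e) x| ≤ 1 := by
  obtain ⟨y, hy⟩ := D.nonempty_face he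
  rw [pev_heightPoly, abs_mul, abs_of_pos (inv_pos.2 hD.pos), inv_mul_le_one₀ hD.pos,
    D.height_eq_inner he hy]
  refine (abs_real_inner_le_norm _ _).trans ?_
  rw [(D.isOutwardNormal e he).norm_eq, mul_one, ← dist_eq_norm]
  exact hD.dist_le x hx y (D.face_subset hD.isPolytope he hy)

/-- The hyperplane of a face cannot be close to all of a ball of radius `h`. -/
theorem exists_one_le_abs_heightPoly (hD : D.IsRegular ϱ δ N h) {e : Set (E (m + 1))}
    (he : e ∈ F) (x₀ : E (m + 1)) :
    ∃ z ∈ Metric.closedBall x₀ h, 1 ≤ |pev (D.heightPoly h e) z| := by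
  have hn := (D.isOutwardNormal e he).norm_eq
  have hmem : ∀ σ : ℝ, |σ| = h → x₀ + σ • D.normal e ∈ Metric.closedBall x₀ h := fun σ hσ => by
    simp [norm_smul, hn, hσ]
  have hval : ∀ σ : ℝ, pev (D.heightPoly h e) (x₀ + σ • D.normal e) =
      h⁻¹ * (D.height e x₀ + σ) := fun σ => by
    have h1 : x₀ + σ • D.normal e - D.chart e 0 = (x₀ - D.chart e 0) + σ • D.normal e := by abel
    rw [pev_heightPoly, height, h1, inner_add_left, inner_smul_left,
      real_inner_self_eq_norm_sq, hn]
    simp [height]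
  rcases le_total 0 (D.height e x₀) with h0 | h0
  · refine ⟨_, hmem h (abs_of_pos hD.pos), ?_⟩
    rw [hval, abs_mul, abs_of_pos (inv_pos.2 hD.pos), le_inv_mul_iff₀ hD.pos, mul_one]
    exact le_trans (by linarith) (le_abs_self _)
  · refine ⟨_, hmem (-h) (by rw [abs_neg, abs_of_pos hD.pos]), ?_⟩
    rw [hval, abs_mul, abs_of_pos (inv_pos.2 hD.pos), le_inv_mul_iff₀ hD.pos, mul_one]
    exact le_trans (by linarith) (neg_le_abs _)

/-- A bubble function for the faces in `J`: it vanishes on these faces and is at least the square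
of the product of the scaled heights. On a convex element the heights have a constant sign and
their product will do; otherwise it has to be squared, which doubles the degree. -/
theorem exists_bubble (hD : D.IsRegular ϱ δ N h) {J : Finset (Set (E (m + 1)))} (hJ : J ⊆ F) :
    ∃ β : Poly (m + 1), β.totalDegree ≤ (if Convex ℝ T then J.card else 2 * J.card) ∧
      (∀ x ∈ T, (∏ e ∈ J, pev (D.heightPoly h e) x) ^ 2 ≤ pev β x ∧ 0 ≤ pev β x ∧ pev β x ≤ 1) ∧
      ∀ e ∈ J, ∀ x ∈ e, pev β x = 0 := by
  have hdeg : (∏ e ∈ J, D.heightPoly h e).totalDegree ≤ J.card := by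
    refine (MvPolynomial.totalDegree_finsetProd _ _).trans ?_
    exact (Finset.sum_le_sum fun e _ => D.totalDegree_heightPoly_le h e).trans (by simp)
  have hzero : ∀ e ∈ J, ∀ x ∈ e, ∏ e' ∈ J, pev (D.heightPoly h e') x = 0 := fun e he x hx =>
    Finset.prod_eq_zero he (by rw [pev_heightPoly, D.height_eq_zero (hJ he) hx, mul_zero])
  have habs : ∀ x ∈ T, |∏ e ∈ J, pev (D.heightPoly h e) x| ≤ 1 := fun x hx => by
    rw [Finset.abs_prod]
    exact Finset.prod_le_one (fun _ _ => abs_nonneg _)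
      fun e he => hD.abs_heightPoly_le_one (hJ he) hx
  split_ifs with hconv
  · have hpev : ∀ x ∈ T, pev (MvPolynomial.C ((-1) ^ J.card) * ∏ e ∈ J, D.heightPoly h e) x =
        |∏ e ∈ J, pev (D.heightPoly h e) x| := fun x hx => by
      rw [Finset.abs_prod, pev_mul, pev_C, pev_prod, ← Finset.prod_const, ← Finset.prod_mul_distrib]
      refine Finset.prod_congr rfl fun e he => ?_
      have : pev (D.heightPoly h e) x ≤ 0 := by
        rw [pev_heightPoly]
        exact mul_nonpos_of_nonneg_of_nonpos (inv_pos.2 hD.pos).le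
          (D.height_nonpos_of_convex hD.isPolytope hconv (hJ he) hx)
      rw [abs_of_nonpos this]
      ring
    refine ⟨MvPolynomial.C ((-1) ^ J.card) * ∏ e ∈ J, D.heightPoly h e, ?_, fun x hx => ?_,
      fun e he x hx => ?_⟩
    · refine (MvPolynomial.totalDegree_mul _ _).trans ?_
      rwa [MvPolynomial.totalDegree_C, zero_add]
    · rw [hpev x hx]
      refine ⟨?_, abs_nonneg _, habs x hx⟩
      rw [← sq_abs]
      exact pow_le_of_le_one (abs_nonneg _) (habs x hx) two_ne_zero
    · rw [pev_mul, pev_prod, hzero e he x hx, mul_zero]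
  · refine ⟨(∏ e ∈ J, D.heightPoly h e) ^ 2, ?_, fun x hx => ?_, fun e he x hx => ?_⟩
    · exact (MvPolynomial.totalDegree_pow _ _).trans (Nat.mul_le_mul_left _ hdeg)
    · rw [pev_pow, pev_prod]
      refine ⟨le_rfl, sq_nonneg _, ?_⟩
      rw [← sq_abs]
      exact pow_le_one₀ (abs_nonneg _) (habs x hx)
    · rw [pev_pow, pev_prod, hzero e he x hx]
      simp

end IsRegular

/-! ### Polynomial inequalities on regular elements -/

/-- The trace inequality: the values of a polynomial on a face are bounded by its maximum over a ball
containing the element, which its `L²` norm over the element controls. -/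
theorem exists_trace_inequality (m r N : ℕ) {ϱ : ℝ} (hϱ : 0 < ϱ) (δ : ℝ) :
    ∃ C : ℝ, 0 < C ∧ ∀ (T : Set (E (m + 1))) (F : Finset (Set (E (m + 1))))
      (D : ElementFaces T F) (h : ℝ), D.IsRegular ϱ δ N h →
      ∀ e ∈ F, ∀ p : Poly (m + 1), p.totalDegree ≤ r →
        h * ∫ x in e, pev p x ^ 2 ∂μHE[m] ≤ C * ∫ x in T, pev p x ^ 2 := by
  obtain ⟨C, hC, hsup⟩ := exists_setIntegral_sq_le_weighted (m + 1) r 0 hϱ one_pos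
  let ω := volume.real (Metric.ball (0 : E m) 1)
  have hω : 0 ≤ ω := measureReal_nonneg
  refine ⟨C * (1 + ω), by positivity, fun T F D h hD e he p hp => ?_⟩
  have hh := hD.pos
  obtain ⟨u₀, hu₀⟩ := D.nonempty_dom he
  have hx₀ : D.chart e u₀ ∈ T := D.face_subset hD.isPolytope he (D.chart_mem he hu₀)
  obtain ⟨hsup, -⟩ := hsup (D.chart e u₀) h hh T hD.isPolytope.isCompact.measurableSet
    (hD.subset_closedBall hx₀) hD.volume_ge PUnit ∅ (fun _ => 0) (by simp) (by simp) (by simp) p hp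
  simp only [Finset.prod_empty, one_pow, one_mul] at hsup
  set I := ∫ x in T, pev p x ^ 2
  have hI : 0 ≤ I := integral_nonneg fun x => sq_nonneg _
  have hPc := (D.isPolytope e he).isCompact
  have hface : ∫ x in e, pev p x ^ 2 ∂μHE[m] = ∫ u in D.dom e, pev p (D.chart e u) ^ 2 := by
    rw [← setIntegral_image_isometry (D.chart e) (D.dom e) (fun x => pev p x ^ 2),
      D.image_eq e he]
  have hcont : Continuous fun u => pev p (D.chart e u) ^ 2 :=
    ((continuous_pev p).comp (D.chart e).continuous).pow 2
  have h1 : ∫ u in D.dom e, pev p (D.chart e u) ^ 2 ≤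
      C * I / h ^ (m + 1) * volume.real (D.dom e) := by
    refine setIntegral_le_mul_measureReal hPc.measurableSet hPc.measure_lt_top.ne
      ((D.isPolytope e he).integrableOn hcont) fun u hu => ?_
    rw [le_div_iff₀ (by positivity), mul_comm]
    exact hsup _ (hD.subset_closedBall hx₀ (D.face_subset hD.isPolytope he (D.chart_mem he hu)))
  have h2 : volume.real (D.dom e) ≤ h ^ m * ω := by
    refine (measureReal_mono (hD.dom_subset_closedBall he hu₀)
      (isCompact_closedBall _ _).measure_lt_top.ne).trans ?_
    rw [Measure.addHaar_real_closedBall _ _ hh.le]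
    simp [ω]
  rw [hface]
  calc h * ∫ u in D.dom e, pev p (D.chart e u) ^ 2
      ≤ h * (C * I / h ^ (m + 1) * (h ^ m * ω)) := by
        gcongr
        exact h1.trans (by gcongr)
    _ = C * ω * I := by rw [pow_succ]; field_simp
    _ ≤ C * (1 + ω) * I := by gcongr; linarith

/-- The `L²` norm over the element survives weighting by the squared heights above all faces, since
no hyperplane is close to all of a ball of the size of the element. -/
theorem exists_interior_bubble_inequality (m r N : ℕ) {ϱ : ℝ} (hϱ : 0 < ϱ) (δ : ℝ) :
    ∃ C : ℝ, 0 < C ∧ ∀ (T : Set (E (m + 1))) (F : Finset (Set (E (m + 1))))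
      (D : ElementFaces T F) (h : ℝ), D.IsRegular ϱ δ N h →
      ∀ p : Poly (m + 1), p.totalDegree ≤ r →
        ∫ x in T, pev p x ^ 2 ≤
          C * ∫ x in T, (∏ e ∈ F, pev (D.heightPoly h e) x) ^ 2 * pev p x ^ 2 := by
  obtain ⟨C, hC, hsup⟩ := exists_setIntegral_sq_le_weighted (m + 1) r N hϱ one_pos
  refine ⟨C, hC, fun T F D h hD p hp => ?_⟩
  obtain ⟨x₀, hx₀⟩ := hD.nonempty
  exact (hsup x₀ h hD.pos T hD.isPolytope.isCompact.measurableSet (hD.subset_closedBall hx₀)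
    hD.volume_ge _ F (D.heightPoly h) hD.card_le (fun e _ => D.totalDegree_heightPoly_le h e)
    (fun e he => hD.exists_one_le_abs_heightPoly he x₀) p hp).2

/-- The orthogonal projection onto the hyperplane of the face `e`, in the coordinates of
`chart e`. -/
noncomputable def retraction (D : ElementFaces T F) (e : Set (E (m + 1))) :
    E (m + 1) →ᵃ[ℝ] E m :=
  ((D.chart e).linearIsometry.toContinuousLinearMap.adjoint.toLinearMap.toAffineMap).comp
    (AffineMap.id ℝ (E (m + 1)) - AffineMap.const ℝ (E (m + 1)) (D.chart e 0))

theorem retraction_apply (D : ElementFaces T F) (e : Set (E (m + 1))) (x : E (m + 1)) :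
    D.retraction e x =
      (D.chart e).linearIsometry.toContinuousLinearMap.adjoint (x - D.chart e 0) := rfl

theorem retraction_chart (D : ElementFaces T F) (e : Set (E (m + 1))) (u : E m) :
    D.retraction e (D.chart e u) = u := by
  have h : D.chart e u - D.chart e 0 = (D.chart e).linearIsometry u := by
    simpa using ((D.chart e).map_vsub u 0).symm
  rw [retraction_apply, h]
  refine ext_inner_right ℝ fun v => ?_
  rw [ContinuousLinearMap.adjoint_inner_left]
  exact (D.chart e).linearIsometry.inner_map_map u v

theorem dist_retraction_le (D : ElementFaces T F) (e : Set (E (m + 1))) (x y : E (m + 1)) :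
    dist (D.retraction e x) (D.retraction e y) ≤ dist x y := by
  rw [retraction_apply, retraction_apply, dist_eq_norm, dist_eq_norm, ← map_sub,
    sub_sub_sub_cancel_right]
  refine (ContinuousLinearMap.le_opNorm _ _).trans ?_
  refine mul_le_of_le_one_left (norm_nonneg _) ?_
  rw [LinearIsometryEquiv.norm_map]
  exact (D.chart e).linearIsometry.norm_toContinuousLinearMap_le

/-- Extending a polynomial on a face constantly along the normal: the extension over the element
and the polynomial on the face are controlled by its `L²` norm on the face, weighted by the heights
above the other faces. -/
theorem exists_face_bubble_inequality (m k N : ℕ) {ϱ δ : ℝ} (hϱ : 0 < ϱ) (hδ : 0 < δ) :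
    ∃ C : ℝ, 0 < C ∧ ∀ (T : Set (E (m + 1))) (F : Finset (Set (E (m + 1))))
      (D : ElementFaces T F) (h : ℝ), D.IsRegular ϱ δ N h →
      ∀ e ∈ F, ∀ p : Poly (m + 1), p.totalDegree ≤ k →
        (∫ x in e, pev p x ^ 2 ∂μHE[m] ≤ C * ∫ x in e,
          (∏ e' ∈ F.erase e, pev (D.heightPoly h e') x) ^ 2 * pev p x ^ 2 ∂μHE[m]) ∧
        ∃ Q : Poly (m + 1), Q.totalDegree ≤ k ∧ (∀ x ∈ e, pev Q x = pev p x) ∧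
          ∫ x in T, pev Q x ^ 2 ≤ C * h * ∫ x in e,
            (∏ e' ∈ F.erase e, pev (D.heightPoly h e') x) ^ 2 * pev p x ^ 2 ∂μHE[m] := by
  obtain ⟨C, hC, hsup⟩ := exists_setIntegral_sq_le_weighted m k N hϱ hδ
  let ω := volume.real (Metric.ball (0 : E (m + 1)) 1)
  have hω : 0 ≤ ω := measureReal_nonneg
  refine ⟨C * (1 + ω), by positivity, fun T F D h hD e he p hp => ?_⟩
  have hh := hD.pos
  obtain ⟨u₀, hu₀⟩ := D.nonempty_dom he
  have hx₀ : D.chart e u₀ ∈ T := D.face_subset hD.isPolytope he (D.chart_mem he hu₀)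
  have hPc := (D.isPolytope e he).isCompact
  have hTc := hD.isPolytope.isCompact
  obtain ⟨q, hq, hqp⟩ := exists_pev_comp_affine (D.chart e).toAffineMap p
  choose w hw hwp using fun e' =>
    exists_pev_comp_affine (D.chart e).toAffineMap (D.heightPoly h e')
  obtain ⟨Q, hQ, hQq⟩ := exists_pev_comp_affine (D.retraction e) q
  have hface : ∀ g : E (m + 1) → ℝ,
      ∫ x in e, g x ∂μHE[m] = ∫ u in D.dom e, g (D.chart e u) := fun g => by
    rw [← setIntegral_image_isometry (D.chart e) (D.dom e) g, D.image_eq e he]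
  set I := ∫ x in e, (∏ e' ∈ F.erase e, pev (D.heightPoly h e') x) ^ 2 * pev p x ^ 2 ∂μHE[m]
    with hI
  have hI0 : 0 ≤ I := integral_nonneg fun x => by positivity
  have hIq : I = ∫ u in D.dom e, (∏ e' ∈ F.erase e, pev (w e') u) ^ 2 * pev q u ^ 2 := by
    rw [hI, hface]
    simp only [hwp, hqp, AffineIsometry.coe_toAffineMap]
  obtain ⟨hsup, hL2⟩ := hsup u₀ h hh (D.dom e) hPc.measurableSet
    (hD.dom_subset_closedBall he hu₀) (hD.volume_dom_ge e he) _ (F.erase e) w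
    ((Finset.card_le_card (Finset.erase_subset _ _)).trans hD.card_le)
    (fun e' _ => (hw e').trans (D.totalDegree_heightPoly_le h e'))
    (fun e' he' => by
      obtain ⟨u, hu, hu'⟩ := hD.exists_height_ge e he e' (Finset.mem_of_mem_erase he')
        (Finset.ne_of_mem_erase he').symm
      refine ⟨u, hD.dom_subset_closedBall he hu₀ hu, ?_⟩
      rw [hwp, AffineIsometry.coe_toAffineMap, pev_heightPoly, abs_mul,
        abs_of_pos (inv_pos.2 hh), le_inv_mul_iff₀ hh, mul_comm]
      exact hu')
    q (hq.trans hp)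
  rw [← hIq] at hsup hL2
  refine ⟨?_, Q, (hQ.trans hq).trans hp, fun x hx => ?_, ?_⟩
  · rw [hface]
    simp only [hqp, AffineIsometry.coe_toAffineMap] at hL2
    refine hL2.trans ?_
    gcongr
    nlinarith
  · obtain ⟨u, -, rfl⟩ := (D.image_eq e he).superset hx
    rw [hQq, D.retraction_chart, hqp, AffineIsometry.coe_toAffineMap]
  · have h1 : ∫ x in T, pev Q x ^ 2 ≤ C * I / h ^ m * volume.real T := by
      refine setIntegral_le_mul_measureReal hTc.measurableSet hTc.measure_lt_top.ne
        (hD.isPolytope.integrableOn ((continuous_pev Q).pow 2)) fun x hx => ?_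
      rw [le_div_iff₀ (by positivity), mul_comm, hQq]
      refine hsup _ ?_
      rw [Metric.mem_closedBall]
      conv_lhs => rw [← D.retraction_chart e u₀]
      exact (D.dist_retraction_le e _ _).trans (hD.dist_le x hx _ hx₀)
    have h2 : volume.real T ≤ h ^ (m + 1) * ω := by
      refine (measureReal_mono (hD.subset_closedBall hx₀)
        (isCompact_closedBall _ _).measure_lt_top.ne).trans ?_
      rw [Measure.addHaar_real_closedBall _ _ hh.le]
      simp [ω]
    calc _ ≤ C * I / h ^ m * (h ^ (m + 1) * ω) := h1.trans (by gcongr)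
      _ = C * ω * h * I := by rw [pow_succ]; field_simp
      _ ≤ C * (1 + ω) * h * I := by gcongr; linarith

end ElementFaces

end Regular

/-! ### The weak gradient on one element -/

section Local

variable {m : ℕ} {T : Set (E (m + 1))} {F : Finset (Set (E (m + 1)))}

namespace ElementFaces

/-- Integration by parts in the definition of the weak gradient: it differs from the gradient of
`u0` by the jump of the boundary values. -/
theorem integral_weakGradient_mul (D : ElementFaces T F) (hT : IsPolytope T)
    (hnormal : ∀ e ∈ F, D.normal e = outwardNormal T e) {r : ℕ} {u0 : Poly (m + 1)}
    {ub : Set (E (m + 1)) → Poly (m + 1)} {g : Fin (m + 1) → Poly (m + 1)}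
    (hg : IsDiscreteWeakGradient r T F u0 ub g) {φ : Fin (m + 1) → Poly (m + 1)}
    (hφ : ∀ i, (φ i).totalDegree ≤ r) :
    ∫ x in T, ∑ i, pev (g i) x * pev (φ i) x =
      (∫ x in T, ∑ i, pev (MvPolynomial.pderiv i u0) x * pev (φ i) x) +
      ∑ e ∈ F, ∫ x in e, (pev (ub e) x - pev u0 x) * ∑ i, pev (φ i) x * D.normal e i ∂μHE[m] := by
  have hc := fun p : Poly (m + 1) => continuous_pev p
  have hdiv : (∫ x in T, ∑ i, pev (MvPolynomial.pderiv i u0) x * pev (φ i) x) +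
      ∫ x in T, pev u0 x * ∑ i, pev (MvPolynomial.pderiv i (φ i)) x =
      ∑ e ∈ F, ∫ x in e, pev u0 x * ∑ i, pev (φ i) x * D.normal e i ∂μHE[m] := by
    rw [← integral_add (hT.integrableOn (by fun_prop)) (hT.integrableOn (by fun_prop))]
    have h1 : ∀ x, ∑ i, pev (MvPolynomial.pderiv i u0) x * pev (φ i) x +
        pev u0 x * ∑ i, pev (MvPolynomial.pderiv i (φ i)) x =
        ∑ i, pev (MvPolynomial.pderiv i (u0 * φ i)) x := fun x => by
      rw [Finset.mul_sum, ← Finset.sum_add_distrib]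
      refine Finset.sum_congr rfl fun i _ => ?_
      simp only [Derivation.leibniz, smul_eq_mul, pev_add, pev_mul]
      ring
    simp only [h1]
    rw [integral_finsetSum _ fun i _ => hT.integrableOn (hc _)]
    simp only [D.setIntegral_pderiv hT]
    rw [Finset.sum_comm]
    refine Finset.sum_congr rfl fun e he => ?_
    simp only [← integral_const_mul]
    rw [← integral_finsetSum _ fun i _ => D.integrableOn_face he (by fun_prop)]
    refine integral_congr_ae (Eventually.of_forall fun x => ?_)
    simp only [pev_mul, Finset.mul_sum]
    exact Finset.sum_congr rfl fun i _ => by ring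
  have hdef : ∫ x in T, ∑ i, pev (g i) x * pev (φ i) x =
      -(∫ x in T, pev u0 x * ∑ i, pev (MvPolynomial.pderiv i (φ i)) x) +
      ∑ e ∈ F, ∫ x in e, pev (ub e) x * ∑ i, pev (φ i) x * D.normal e i ∂μHE[m] := by
    refine (hg.2 φ hφ).trans (congrArg _ (Finset.sum_congr rfl fun e he => ?_))
    rw [hnormal e he]
    rfl
  have hsub : ∀ e ∈ F,
      ∫ x in e, (pev (ub e) x - pev u0 x) * ∑ i, pev (φ i) x * D.normal e i ∂μHE[m] =
      (∫ x in e, pev (ub e) x * ∑ i, pev (φ i) x * D.normal e i ∂μHE[m]) -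
      ∫ x in e, pev u0 x * ∑ i, pev (φ i) x * D.normal e i ∂μHE[m] := fun e he => by
    rw [← integral_sub (D.integrableOn_face he (by fun_prop))
      (D.integrableOn_face he (by fun_prop))]
    simp only [sub_mul]
  rw [hdef, Finset.sum_congr rfl hsub, Finset.sum_sub_distrib, ← hdiv]
  ring

theorem sq_sum_mul_normal_le (D : ElementFaces T F) {e : Set (E (m + 1))} (he : e ∈ F)
    (a : Fin (m + 1) → ℝ) : (∑ i, a i * D.normal e i) ^ 2 ≤ ∑ i, a i ^ 2 := by
  have hn : ∑ i, D.normal e i ^ 2 = 1 := by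
    rw [← EuclideanSpace.real_norm_sq_eq, (D.isOutwardNormal e he).norm_eq, one_pow]
  simpa [hn] using Finset.sum_mul_sq_le_sq_mul_sq Finset.univ a fun i => D.normal e i

/-- The weak gradient is tested with itself, and its boundary values are estimated by the trace
inequality. -/
theorem exists_weakGradient_le (m R N : ℕ) {ϱ : ℝ} (hϱ : 0 < ϱ) (δ : ℝ) :
    ∃ C : ℝ, 0 < C ∧ ∀ (T : Set (E (m + 1))) (F : Finset (Set (E (m + 1))))
      (D : ElementFaces T F) (h : ℝ), D.IsRegular ϱ δ N h →
      (∀ e ∈ F, D.normal e = outwardNormal T e) → ∀ r ≤ R, ∀ u0 ub g,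
      IsDiscreteWeakGradient r T F u0 ub g →
      ∫ x in T, ∑ i, pev (g i) x ^ 2 ≤
        C * ((∫ x in T, ∑ i, pev (MvPolynomial.pderiv i u0) x ^ 2) +
          h⁻¹ * ∑ e ∈ F, ∫ x in e, (pev u0 x - pev (ub e) x) ^ 2 ∂μHE[m]) := by
  obtain ⟨C, hC, htr⟩ := exists_trace_inequality m R N hϱ δ
  let K := C * ((N : ℝ) + 1)
  have hK : 0 < K := by positivity
  refine ⟨2 + 2 * K, by positivity, fun T F D h hD hnormal r hr u0 ub g hg => ?_⟩
  have hc := fun p : Poly (m + 1) => continuous_pev p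
  have hT := hD.isPolytope
  have hh := hD.pos
  have hid := D.integral_weakGradient_mul hT hnormal hg hg.1
  have hsq : ∫ x in T, ∑ i, pev (g i) x * pev (g i) x = ∫ x in T, ∑ i, pev (g i) x ^ 2 := by
    simp only [sq]
  rw [hsq] at hid
  set G := ∫ x in T, ∑ i, pev (g i) x ^ 2 with hG
  set A := ∫ x in T, ∑ i, pev (MvPolynomial.pderiv i u0) x ^ 2 with hA
  set J : Set (E (m + 1)) → ℝ :=
    fun e => ∫ x in e, (pev u0 x - pev (ub e) x) ^ 2 ∂μHE[m] with hJ
  have hG0 : 0 ≤ G := integral_nonneg fun x => Finset.sum_nonneg fun i _ => sq_nonneg _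
  have hA0 : 0 ≤ A := integral_nonneg fun x => Finset.sum_nonneg fun i _ => sq_nonneg _
  have hJ0 : ∀ e, 0 ≤ J e := fun e => integral_nonneg fun x => sq_nonneg _
  have h1 : ∫ x in T, ∑ i, pev (MvPolynomial.pderiv i u0) x * pev (g i) x ≤ A + 1 / 4 * G := by
    rw [hA, hG, ← integral_const_mul,
      ← integral_add (hT.integrableOn (by fun_prop)) (hT.integrableOn (by fun_prop))]
    refine integral_mono (hT.integrableOn (by fun_prop)) (hT.integrableOn (by fun_prop))
      fun x => ?_
    simp only [Finset.mul_sum]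
    rw [← Finset.sum_add_distrib]
    refine Finset.sum_le_sum fun i _ => ?_
    nlinarith [sq_nonneg (pev (MvPolynomial.pderiv i u0) x - 1 / 2 * pev (g i) x)]
  have htrace : ∀ e ∈ F, ∫ x in e, ∑ i, pev (g i) x ^ 2 ∂μHE[m] ≤ C * h⁻¹ * G := fun e he => by
    rw [hG, integral_finsetSum _ fun i _ => D.integrableOn_face he (by fun_prop),
      integral_finsetSum _ fun i _ => hT.integrableOn (by fun_prop), Finset.mul_sum]
    refine Finset.sum_le_sum fun i _ => ?_
    have := htr T F D h hD e he (g i) ((hg.1 i).trans hr)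
    rw [mul_right_comm, ← div_eq_mul_inv, le_div_iff₀ hh, mul_comm _ h]
    exact this
  have h2 : ∀ e ∈ F,
      ∫ x in e, (pev (ub e) x - pev u0 x) * ∑ i, pev (g i) x * D.normal e i ∂μHE[m] ≤
        K * h⁻¹ * J e + 1 / (4 * ((N : ℝ) + 1)) * G := fun e he => by
    have h3 : ∫ x in e, (pev (ub e) x - pev u0 x) * ∑ i, pev (g i) x * D.normal e i ∂μHE[m] ≤
        K * h⁻¹ * J e + h / (4 * K) * ∫ x in e, ∑ i, pev (g i) x ^ 2 ∂μHE[m] := by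
      rw [hJ]
      simp only
      rw [← integral_const_mul, ← integral_const_mul,
        ← integral_add (D.integrableOn_face he (by fun_prop))
          (D.integrableOn_face he (by fun_prop))]
      refine integral_mono (D.integrableOn_face he (by fun_prop))
        (D.integrableOn_face he (by fun_prop)) fun x => ?_
      have hs := D.sq_sum_mul_normal_le he fun i => pev (g i) x
      simp only
      set s := ∑ i, pev (g i) x * D.normal e i
      have h4 : h / (4 * K) * s ^ 2 ≤ h / (4 * K) * ∑ i, pev (g i) x ^ 2 := by gcongr
      have h5 : K * h⁻¹ * (pev u0 x - pev (ub e) x) ^ 2 + h / (4 * K) * s ^ 2 -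
          (pev (ub e) x - pev u0 x) * s =
          K * h⁻¹ * (pev u0 x - pev (ub e) x + h / (2 * K) * s) ^ 2 := by
        field_simp
        ring
      have h6 : 0 ≤ K * h⁻¹ * (pev u0 x - pev (ub e) x + h / (2 * K) * s) ^ 2 := by positivity
      linarith
    refine h3.trans (add_le_add_right ?_ _)
    calc h / (4 * K) * ∫ x in e, ∑ i, pev (g i) x ^ 2 ∂μHE[m]
        ≤ h / (4 * K) * (C * h⁻¹ * G) := by
          gcongr
          exact htrace e he
      _ = 1 / (4 * ((N : ℝ) + 1)) * G := by
          simp only [K]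
          field_simp
  have h3 := Finset.sum_le_sum h2
  rw [Finset.sum_add_distrib, ← Finset.mul_sum, Finset.sum_const, nsmul_eq_mul] at h3
  have hcard : (F.card : ℝ) ≤ N := by exact_mod_cast hD.card_le
  have h4 : (F.card : ℝ) * (1 / (4 * ((N : ℝ) + 1)) * G) ≤ 1 / 4 * G := by
    rw [← mul_assoc]
    gcongr
    rw [mul_one_div, div_le_div_iff₀ (by positivity) (by norm_num)]
    linarith
  have h5 : 0 ≤ h⁻¹ * ∑ e ∈ F, J e :=
    mul_nonneg (inv_pos.2 hh).le (Finset.sum_nonneg fun e _ => hJ0 e)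
  have h6 : K * h⁻¹ * ∑ e ∈ F, J e = K * (h⁻¹ * ∑ e ∈ F, J e) := by ring
  nlinarith [mul_nonneg hK.le hA0]

/-- The weak gradient is tested with the gradient of `u0` times the bubble function of all faces,
which has no boundary values. -/
theorem exists_gradient_le_weakGradient (m k N : ℕ) {ϱ : ℝ} (hϱ : 0 < ϱ) (δ : ℝ) :
    ∃ C : ℝ, 0 < C ∧ ∀ (T : Set (E (m + 1))) (F : Finset (Set (E (m + 1))))
      (D : ElementFaces T F) (h : ℝ), D.IsRegular ϱ δ N h →
      (∀ e ∈ F, D.normal e = outwardNormal T e) → ∀ r,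
      (if Convex ℝ T then k + F.card - 1 else k + 2 * F.card - 1) ≤ r →
      ∀ u0 ub g, u0.totalDegree ≤ k → IsDiscreteWeakGradient r T F u0 ub g →
      ∫ x in T, ∑ i, pev (MvPolynomial.pderiv i u0) x ^ 2 ≤
        C * ∫ x in T, ∑ i, pev (g i) x ^ 2 := by
  obtain ⟨C, hC, hin⟩ := exists_interior_bubble_inequality m k N hϱ δ
  refine ⟨C ^ 2, by positivity, fun T F D h hD hnormal r hr u0 ub g hu0 hg => ?_⟩
  have hc := fun p : Poly (m + 1) => continuous_pev p
  have hT := hD.isPolytope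
  obtain ⟨β, hβdeg, hβ, hβ0⟩ := hD.exists_bubble (Finset.Subset.refl F)
  have hφ : ∀ i, (β * MvPolynomial.pderiv i u0).totalDegree ≤ r := fun i => by
    by_cases h0 : MvPolynomial.pderiv i u0 = 0
    · simp [h0]
    · have h1 := totalDegree_pderiv_add_one_le u0 i h0
      have h2 := MvPolynomial.totalDegree_mul β (MvPolynomial.pderiv i u0)
      split_ifs at hr hβdeg <;> omega
  have hid := D.integral_weakGradient_mul hT hnormal hg hφ
  rw [Finset.sum_eq_zero, add_zero] at hid
  rotate_left
  · intro e he
    refine setIntegral_eq_zero_of_forall_eq_zero fun x hx => ?_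
    simp [hβ0 e he x hx]
  set G := ∫ x in T, ∑ i, pev (g i) x ^ 2 with hG
  set A := ∫ x in T, ∑ i, pev (MvPolynomial.pderiv i u0) x ^ 2 with hA
  have h1 : A ≤ C * ∫ x in T, ∑ i, pev (MvPolynomial.pderiv i u0) x *
      pev (β * MvPolynomial.pderiv i u0) x := by
    rw [hA, integral_finsetSum _ fun i _ => hT.integrableOn (by fun_prop),
      integral_finsetSum _ fun i _ => hT.integrableOn (by fun_prop), Finset.mul_sum]
    refine Finset.sum_le_sum fun i _ => ?_
    have hdeg : (MvPolynomial.pderiv i u0).totalDegree ≤ k := by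
      by_cases h0 : MvPolynomial.pderiv i u0 = 0
      · simp [h0]
      · have := totalDegree_pderiv_add_one_le u0 i h0
        omega
    refine (hin T F D h hD _ hdeg).trans ?_
    refine mul_le_mul_of_nonneg_left ?_ hC.le
    refine setIntegral_mono_on (hT.integrableOn ?_) (hT.integrableOn (by fun_prop))
      hT.isCompact.measurableSet fun x hx => ?_
    · exact ((continuous_finsetProd _ fun e _ => hc _).pow 2).mul ((hc _).pow 2)
    · have := (hβ x hx).1
      rw [pev_mul]
      nlinarith [mul_le_mul_of_nonneg_right this
        (sq_nonneg (pev (MvPolynomial.pderiv i u0) x))]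
  have h2 : ∫ x in T, ∑ i, pev (g i) x * pev (β * MvPolynomial.pderiv i u0) x ≤
      C / 2 * G + 1 / (2 * C) * A := by
    rw [hG, hA, ← integral_const_mul, ← integral_const_mul,
      ← integral_add (hT.integrableOn (by fun_prop)) (hT.integrableOn (by fun_prop))]
    refine setIntegral_mono_on (hT.integrableOn (by fun_prop)) (hT.integrableOn (by fun_prop))
      hT.isCompact.measurableSet fun x hx => ?_
    rw [Finset.mul_sum, Finset.mul_sum, ← Finset.sum_add_distrib]
    refine Finset.sum_le_sum fun i _ => ?_
    obtain ⟨-, hb0, hb1⟩ := hβ x hx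
    rw [pev_mul]
    set b := pev β x
    set a := pev (MvPolynomial.pderiv i u0) x
    set y := pev (g i) x
    have h3 : C / 2 * y ^ 2 + 1 / (2 * C) * (b * a) ^ 2 - y * (b * a) =
        1 / (2 * C) * (C * y - b * a) ^ 2 := by
      field_simp
      ring
    have h4 : 0 ≤ 1 / (2 * C) * (C * y - b * a) ^ 2 := by positivity
    have h5 : 1 / (2 * C) * (b * a) ^ 2 ≤ 1 / (2 * C) * a ^ 2 := by
      gcongr 1 / (2 * C) * ?_
      rw [mul_pow]
      exact mul_le_of_le_one_left (sq_nonneg _) (pow_le_one₀ hb0 hb1)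
    linarith
  rw [← hid] at h1
  have h3 := h1.trans (mul_le_mul_of_nonneg_left h2 hC.le)
  have h4 : C * (C / 2 * G + 1 / (2 * C) * A) = C ^ 2 / 2 * G + A / 2 := by
    field_simp
  linarith

/-- The weak gradient is tested with the jump on one face, extended constantly along the normal and
multiplied by the bubble function of the other faces. -/
theorem exists_jump_le_weakGradient (m k N : ℕ) {ϱ δ : ℝ} (hϱ : 0 < ϱ) (hδ : 0 < δ) :
    ∃ C : ℝ, 0 < C ∧ ∀ (T : Set (E (m + 1))) (F : Finset (Set (E (m + 1))))
      (D : ElementFaces T F) (h : ℝ), D.IsRegular ϱ δ N h →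
      (∀ e ∈ F, D.normal e = outwardNormal T e) → ∀ r,
      (if Convex ℝ T then k + F.card - 1 else k + 2 * F.card - 1) ≤ r →
      ∀ u0 ub g, u0.totalDegree ≤ k → (∀ e ∈ F, (ub e).totalDegree ≤ k) →
      IsDiscreteWeakGradient r T F u0 ub g → ∀ e ∈ F,
      h⁻¹ * ∫ x in e, (pev u0 x - pev (ub e) x) ^ 2 ∂μHE[m] ≤
        C * ((∫ x in T, ∑ i, pev (MvPolynomial.pderiv i u0) x ^ 2) +
          ∫ x in T, ∑ i, pev (g i) x ^ 2) := by
  obtain ⟨C, hC, hface⟩ := exists_face_bubble_inequality m k N hϱ hδ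
  refine ⟨2 * C ^ 2, by positivity, fun T F D h hD hnormal r hr u0 ub g hu0 hub hg e he => ?_⟩
  have hc := fun p : Poly (m + 1) => continuous_pev p
  have hT := hD.isPolytope
  have hh := hD.pos
  have hn : ∑ i, D.normal e i ^ 2 = 1 := by
    rw [← EuclideanSpace.real_norm_sq_eq, (D.isOutwardNormal e he).norm_eq, one_pow]
  obtain ⟨β, hβdeg, hβ, hβ0⟩ := hD.exists_bubble (Finset.erase_subset e F)
  have hpdeg : (u0 - ub e).totalDegree ≤ k :=
    (MvPolynomial.totalDegree_sub _ _).trans (max_le hu0 (hub e he))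
  obtain ⟨hJ, Q, hQdeg, hQ, hQT⟩ := hface T F D h hD e he (u0 - ub e) hpdeg
  set I := ∫ x in e, (∏ e' ∈ F.erase e, pev (D.heightPoly h e') x) ^ 2 *
    pev (u0 - ub e) x ^ 2 ∂μHE[m] with hI
  set I' := ∫ x in e, pev β x * pev (u0 - ub e) x ^ 2 ∂μHE[m] with hI'
  have hII' : I ≤ I' := by
    refine setIntegral_mono_on (D.integrableOn_face he ?_) (D.integrableOn_face he (by fun_prop))
      (D.isCompact_face he).measurableSet fun x hx => ?_
    · exact ((continuous_finsetProd _ fun e _ => hc _).pow 2).mul ((hc _).pow 2)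
    · exact mul_le_mul_of_nonneg_right (hβ x (D.face_subset hT he hx)).1 (sq_nonneg _)
  let φ : Fin (m + 1) → Poly (m + 1) := fun i => MvPolynomial.C (D.normal e i) * (β * Q)
  have hφ : ∀ i, (φ i).totalDegree ≤ r := fun i => by
    have h1 := MvPolynomial.totalDegree_mul (MvPolynomial.C (D.normal e i)) (β * Q)
    rw [MvPolynomial.totalDegree_C, zero_add] at h1
    have h2 := MvPolynomial.totalDegree_mul β Q
    have h3 := Finset.card_pos.2 ⟨e, he⟩
    rw [Finset.card_erase_of_mem he] at hβdeg
    refine h1.trans ?_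
    split_ifs at hr hβdeg <;> omega
  have hid := D.integral_weakGradient_mul hT hnormal hg hφ
  rw [Finset.sum_eq_single_of_mem e he] at hid
  rotate_left
  · intro e' he' hne
    refine setIntegral_eq_zero_of_forall_eq_zero fun x hx => ?_
    simp [φ, hβ0 e' (Finset.mem_erase.2 ⟨hne, he'⟩) x hx]
  have hbd : ∫ x in e, (pev (ub e) x - pev u0 x) * ∑ i, pev (φ i) x * D.normal e i ∂μHE[m] =
      -I' := by
    rw [hI', ← integral_neg]
    refine setIntegral_congr_fun (D.isCompact_face he).measurableSet fun x hx => ?_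
    have h1 : ∑ i, pev (φ i) x * D.normal e i = pev β x * pev (u0 - ub e) x := by
      have : ∀ i, pev (φ i) x * D.normal e i = D.normal e i ^ 2 * (pev β x * pev Q x) := fun i => by
        simp only [φ, pev_mul, pev_C]
        ring
      simp only [this]
      rw [← Finset.sum_mul, hn, one_mul, hQ x hx]
    simp only [h1, pev_sub]
    ring
  rw [hbd] at hid
  set G := ∫ x in T, ∑ i, pev (g i) x ^ 2 with hG
  set A := ∫ x in T, ∑ i, pev (MvPolynomial.pderiv i u0) x ^ 2 with hA
  have hI'eq : I' = ∫ x in T, ∑ i, (pev (MvPolynomial.pderiv i u0) x - pev (g i) x) *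
      pev (φ i) x := by
    have : (∫ x in T, ∑ i, pev (MvPolynomial.pderiv i u0) x * pev (φ i) x) -
        ∫ x in T, ∑ i, pev (g i) x * pev (φ i) x = I' := by rw [hid]; ring
    rw [← this, ← integral_sub (hT.integrableOn (by fun_prop)) (hT.integrableOn (by fun_prop))]
    simp only [← Finset.sum_sub_distrib, ← sub_mul]
  have hkey : I' ≤ 1 / (2 * (C * h)) * (∫ x in T, pev Q x ^ 2) + C * h * (A + G) := by
    rw [hI'eq, hA, hG, ← integral_add (hT.integrableOn (by fun_prop))
      (hT.integrableOn (by fun_prop)), ← integral_const_mul, ← integral_const_mul,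
      ← integral_add (hT.integrableOn (by fun_prop)) (hT.integrableOn (by fun_prop))]
    refine setIntegral_mono_on (hT.integrableOn (by fun_prop)) (hT.integrableOn (by fun_prop))
      hT.isCompact.measurableSet fun x hx => ?_
    obtain ⟨-, hb0, hb1⟩ := hβ x hx
    set s := ∑ i, (pev (MvPolynomial.pderiv i u0) x - pev (g i) x) * D.normal e i with hs
    have h1 : ∑ i, (pev (MvPolynomial.pderiv i u0) x - pev (g i) x) * pev (φ i) x =
        s * (pev β x * pev Q x) := by
      rw [hs, Finset.sum_mul]
      refine Finset.sum_congr rfl fun i _ => ?_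
      simp only [φ, pev_mul, pev_C]
      ring
    have h2 : s ^ 2 ≤ 2 * (∑ i, pev (MvPolynomial.pderiv i u0) x ^ 2 +
        ∑ i, pev (g i) x ^ 2) := by
      refine (D.sq_sum_mul_normal_le he _).trans ?_
      rw [← Finset.sum_add_distrib, Finset.mul_sum]
      refine Finset.sum_le_sum fun i _ => ?_
      nlinarith [sq_nonneg (pev (MvPolynomial.pderiv i u0) x + pev (g i) x)]
    rw [h1]
    have hCh : 0 < C * h := by positivity
    have h3 : 1 / (2 * (C * h)) * (pev β x * pev Q x) ^ 2 + C * h / 2 * s ^ 2 -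
        s * (pev β x * pev Q x) =
        1 / (2 * (C * h)) * (pev β x * pev Q x - C * h * s) ^ 2 := by
      field_simp
      ring
    have h4 : 0 ≤ 1 / (2 * (C * h)) * (pev β x * pev Q x - C * h * s) ^ 2 := by positivity
    have h5 : 1 / (2 * (C * h)) * (pev β x * pev Q x) ^ 2 ≤ 1 / (2 * (C * h)) * pev Q x ^ 2 := by
      gcongr 1 / (2 * (C * h)) * ?_
      rw [mul_pow]
      exact mul_le_of_le_one_left (sq_nonneg _) (pow_le_one₀ hb0 hb1)
    have h6 := mul_le_mul_of_nonneg_left h2 (by positivity : 0 ≤ C * h / 2)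
    linarith
  have h1 : 1 / (2 * (C * h)) * (∫ x in T, pev Q x ^ 2) ≤ I' / 2 := by
    calc _ ≤ 1 / (2 * (C * h)) * (C * h * I') := by
          gcongr
          exact hQT.trans (mul_le_mul_of_nonneg_left hII' (by positivity))
      _ = I' / 2 := by field_simp
  have h2 : I' ≤ 2 * (C * h * (A + G)) := by linarith
  have h3 : ∫ x in e, (pev u0 x - pev (ub e) x) ^ 2 ∂μHE[m] ≤ C * I := by
    simpa only [pev_sub] using hJ
  rw [inv_mul_le_iff₀ hh]
  calc _ ≤ C * I := h3
    _ ≤ C * (2 * (C * h * (A + G))) := by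
        gcongr
        exact hII'.trans h2
    _ = h * (2 * C ^ 2 * (A + G)) := by ring

end ElementFaces

end Local

/-! ### Elements of a shape-regular mesh -/

section MeshElements

theorem IsPolytope.diam_pos {m : ℕ} {T : Set (E (m + 1))} (hT : IsPolytope T) :
    0 < Metric.diam T := by
  obtain ⟨x, hx⟩ := hT.isConnected_interior.nonempty
  obtain ⟨ε, hε, hball⟩ := Metric.isOpen_iff.1 isOpen_interior x hx
  have hy : x + (ε / 2) • EuclideanSpace.single 0 (1 : ℝ) ∈ Metric.ball x ε := by
    rw [mem_ball_iff_norm, add_sub_cancel_left, norm_smul]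
    simp [abs_of_pos hε, hε]
  have h := Metric.dist_le_diam_of_mem hT.isCompact.isBounded (interior_subset (hball hy))
    (interior_subset hx)
  rw [dist_eq_norm, add_sub_cancel_left, norm_smul] at h
  simp only [PiLp.norm_single, norm_one, mul_one, Real.norm_eq_abs] at h
  exact lt_of_lt_of_le (by positivity) h

variable {m : ℕ} {Ω : Set (E (m + 1))}

theorem Mesh.isOutwardNormal (M : Mesh Ω) {T e : Set (E (m + 1))} (hT : T ∈ M.elems)
    (he : e ∈ M.facesOf T) : IsOutwardNormal T e (outwardNormal T e) := by
  obtain ⟨he, heT⟩ := Finset.mem_filter.1 he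
  have h := M.exists_normal T hT e he heT
  rw [outwardNormal, dif_pos h]
  exact h.choose_spec

/-- The faces of a mesh element, with the outward normals of the mesh. -/
theorem Mesh.exists_elementFaces (M : Mesh Ω) {T : Set (E (m + 1))} (hT : T ∈ M.elems) :
    ∃ D : ElementFaces T (M.facesOf T), D.normal = outwardNormal T := by
  have : Nonempty (E m →ᵃⁱ[ℝ] E (m + 1)) := ⟨(insertCoordIsometry 0).toAffineIsometry⟩
  have hflat : ∀ e ∈ M.facesOf T, ∃ (f : E m →ᵃⁱ[ℝ] E (m + 1)) (P : Set (E m)),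
      IsPolytope P ∧ e = f '' P := fun e he => M.isFlatFace e (Finset.mem_filter.1 he).1
  choose! f P hP hfP using hflat
  exact ⟨{
    chart := f
    dom := P
    normal := outwardNormal T
    isPolytope := hP
    image_eq := fun e he => (hfP e he).symm
    isOutwardNormal := fun e he => M.isOutwardNormal hT he
    null_inter := fun e he e' he' hne => M.faces_nonoverlapping e (Finset.mem_filter.1 he).1 e'
      (Finset.mem_filter.1 he').1 hne
    frontier_eq := M.frontier_eq T hT }, rfl⟩

theorem Mesh.IsShapeRegular.isRegular {M : Mesh Ω} {S : ShapeConstants} (hM : M.IsShapeRegular S)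
    {T : Set (E (m + 1))} (hT : T ∈ M.elems) (D : ElementFaces T (M.facesOf T)) :
    D.IsRegular (min S.ρv (S.ρe * S.κ ^ m)) S.δ S.N₀ (Metric.diam T) where
  pos := (M.isPolytope T hT).diam_pos
  isPolytope := M.isPolytope T hT
  dist_le _ hx _ hy := Metric.dist_le_diam_of_mem (M.isPolytope T hT).isCompact.isBounded hx hy
  volume_ge := le_trans (mul_le_mul_of_nonneg_right (min_le_left _ _)
    (pow_nonneg Metric.diam_nonneg _)) (hM.vol_elem T hT)
  volume_dom_ge e he := by
    have h1 : S.ρe * Metric.diam e ^ m ≤ μHE[m].real e :=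
      hM.vol_face e (Finset.mem_filter.1 he).1
    have h2 : μHE[m].real e = volume.real (D.dom e) := by
      have h := congrArg μHE[m].real (D.image_eq e he)
      rw [← h, measureReal_def, (D.chart e).isometry.euclideanHausdorffMeasure_image,
        EuclideanSpace.euclideanHausdorffMeasure_eq_volume, ← measureReal_def]
    have h3 := hM.diam_face T hT e he
    have h4 := S.κ_pos
    have h5 := S.ρe_pos
    have h6 : 0 ≤ Metric.diam T := Metric.diam_nonneg
    calc min S.ρv (S.ρe * S.κ ^ m) * Metric.diam T ^ m
        ≤ S.ρe * S.κ ^ m * Metric.diam T ^ m := by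
          gcongr
          exact min_le_right _ _
      _ = S.ρe * (S.κ * Metric.diam T) ^ m := by ring
      _ ≤ S.ρe * Metric.diam e ^ m := by gcongr
      _ ≤ _ := h1.trans h2.le
  card_le := hM.card_faces T hT
  exists_height_ge e he e' he' hne := by
    obtain ⟨x, hx, hδ⟩ := hM.noncoplanar T hT e he e' he' hne
    obtain ⟨u, hu, rfl⟩ := (D.image_eq e he).superset hx
    exact ⟨u, hu, hδ.trans (D.infDist_affineSpan_le_abs_height he' _)⟩

/-- On every element of a shape-regular mesh, the weak gradient is equivalent to the gradient of
`v₀` together with the scaled jump. -/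
theorem exists_local_equivalence (m k q : ℕ) (hq : q ≤ k) (S : ShapeConstants) :
    ∃ C : ℝ, 0 < C ∧ ∀ (Ω : Set (E (m + 1))) (M : Mesh Ω), M.IsShapeRegular S →
      ∀ v ∈ M.Vh k q, ∀ T ∈ M.elems,
      (∫ x in T, ∑ i, pev (M.weakGradient k v T i) x ^ 2) ≤
        C * ((∫ x in T, ∑ i, pev (MvPolynomial.pderiv i (v.v0 T)) x ^ 2) +
          (Metric.diam T)⁻¹ * ∑ e ∈ M.facesOf T,
            ∫ x in e, (pev (v.v0 T) x - pev (v.vb e) x) ^ 2 ∂μHE[m + 1 - 1]) ∧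
      (∫ x in T, ∑ i, pev (MvPolynomial.pderiv i (v.v0 T)) x ^ 2) +
          (Metric.diam T)⁻¹ * ∑ e ∈ M.facesOf T,
            ∫ x in e, (pev (v.v0 T) x - pev (v.vb e) x) ^ 2 ∂μHE[m + 1 - 1] ≤
        C * ∫ x in T, ∑ i, pev (M.weakGradient k v T i) x ^ 2 := by
  have hϱ : 0 < min S.ρv (S.ρe * S.κ ^ m) :=
    lt_min S.ρv_pos (mul_pos S.ρe_pos (pow_pos S.κ_pos m))
  obtain ⟨C₁, hC₁, h₁⟩ := ElementFaces.exists_weakGradient_le m (k + 2 * S.N₀) S.N₀ hϱ S.δ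
  obtain ⟨C₂, hC₂, h₂⟩ := ElementFaces.exists_gradient_le_weakGradient m k S.N₀ hϱ S.δ
  obtain ⟨C₃, hC₃, h₃⟩ := ElementFaces.exists_jump_le_weakGradient m k S.N₀ hϱ S.δ_pos
  refine ⟨C₁ + (C₂ + S.N₀ * (C₃ * (C₂ + 1))), by positivity, fun Ω M hM v hv T hT => ?_⟩
  obtain ⟨D, hD⟩ := M.exists_elementFaces hT
  have hreg := hM.isRegular hT D
  have hnormal : ∀ e ∈ M.facesOf T, D.normal e = outwardNormal T e := fun e _ => by rw [hD]
  have hg : IsDiscreteWeakGradient (M.deg k T) T (M.facesOf T) (v.v0 T) v.vb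
      (M.weakGradient k v T) := by
    have h := (existsUnique_isDiscreteWeakGradient (M.deg k T) (M.isPolytope T hT)
      (F := M.facesOf T) (fun e he => M.isFlatFace e (Finset.mem_filter.1 he).1)
      (v.v0 T) v.vb).exists
    rw [Mesh.weakGradient, dif_pos h]
    exact h.choose_spec
  have hu0 : (v.v0 T).totalDegree ≤ k := hv.1 T hT
  have hub : ∀ e ∈ M.facesOf T, (v.vb e).totalDegree ≤ k := fun e he =>
    (hv.2 e (Finset.mem_filter.1 he).1).trans hq
  have hcard := hM.card_faces T hT
  have hdeg : M.deg k T ≤ k + 2 * S.N₀ := by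
    unfold Mesh.deg
    split_ifs <;> omega
  have b₁ := h₁ T _ D _ hreg hnormal _ hdeg _ _ _ hg
  have b₂ := h₂ T _ D _ hreg hnormal _ (le_refl (M.deg k T)) _ _ _ hu0 hg
  have b₃ := Finset.sum_le_sum
    (h₃ T _ D _ hreg hnormal _ (le_refl (M.deg k T)) _ _ _ hu0 hub hg)
  rw [← Finset.mul_sum, Finset.sum_const, nsmul_eq_mul] at b₃
  change _ ≤ _ * (_ + _ * ∑ e ∈ M.facesOf T,
    ∫ x in e, (pev (v.v0 T) x - pev (v.vb e) x) ^ 2 ∂μHE[m]) ∧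
    _ + _ * ∑ e ∈ M.facesOf T, ∫ x in e, (pev (v.v0 T) x - pev (v.vb e) x) ^ 2 ∂μHE[m] ≤ _
  have hB0 : 0 ≤ (Metric.diam T)⁻¹ * ∑ e ∈ M.facesOf T,
      ∫ x in e, (pev (v.v0 T) x - pev (v.vb e) x) ^ 2 ∂μHE[m] :=
    mul_nonneg (inv_nonneg.2 Metric.diam_nonneg)
      (Finset.sum_nonneg fun e _ => integral_nonneg fun x => sq_nonneg _)
  have hA0 : 0 ≤ ∫ x in T, ∑ i, pev (MvPolynomial.pderiv i (v.v0 T)) x ^ 2 :=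
    integral_nonneg fun x => Finset.sum_nonneg fun i _ => sq_nonneg _
  have hG0 : 0 ≤ ∫ x in T, ∑ i, pev (M.weakGradient k v T i) x ^ 2 :=
    integral_nonneg fun x => Finset.sum_nonneg fun i _ => sq_nonneg _
  set B := (Metric.diam T)⁻¹ * ∑ e ∈ M.facesOf T,
      ∫ x in e, (pev (v.v0 T) x - pev (v.vb e) x) ^ 2 ∂μHE[m]
  set A := ∫ x in T, ∑ i, pev (MvPolynomial.pderiv i (v.v0 T)) x ^ 2
  set G := ∫ x in T, ∑ i, pev (M.weakGradient k v T i) x ^ 2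
  have hcard' : ((M.facesOf T).card : ℝ) ≤ S.N₀ := by exact_mod_cast hcard
  have b₃' : B ≤ S.N₀ * (C₃ * (C₂ + 1)) * G := by
    refine b₃.trans ?_
    calc ((M.facesOf T).card : ℝ) * (C₃ * (A + G)) ≤ S.N₀ * (C₃ * (C₂ * G + G)) := by gcongr
      _ = _ := by ring
  have hN : 0 ≤ (S.N₀ : ℝ) * (C₃ * (C₂ + 1)) := by positivity
  constructor
  · refine b₁.trans (mul_le_mul_of_nonneg_right ?_ (add_nonneg hA0 hB0))
    linarith
  · have : 0 ≤ C₁ * G := by positivity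
    linarith

end MeshElements

/-! ### The convection and reaction terms -/

section Convection

variable {d : ℕ} {Ω : Set (E d)}

theorem volume_hyperplane {a : E d} (ha : a ≠ 0) (s : ℝ) :
    volume {x : E d | inner ℝ a x = s} = 0 := by
  let p : Poly d := ∑ i, MvPolynomial.C (a i) * MvPolynomial.X i - MvPolynomial.C s
  have hp : ∀ x, pev p x = inner ℝ a x - s := fun x => by
    simp [p, PiLp.inner_apply, mul_comm]
  have hp0 : p ≠ 0 := by
    intro h0
    have h1 := hp 0
    have h2 := hp a
    rw [h0, pev_zero, inner_zero_right] at h1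
    rw [h0, pev_zero, real_inner_self_eq_norm_sq] at h2
    have h3 : ‖a‖ ^ 2 = 0 := by linarith
    exact ha (norm_eq_zero.1 (pow_eq_zero_iff two_ne_zero |>.1 h3))
  refine measure_mono_null (fun x hx => ?_) (volume_pev_eq_zero hp0)
  change pev p x = 0
  rw [hp, sub_eq_zero]
  exact hx

theorem IsPolytopalDomain.volume_frontier (hΩ : IsPolytopalDomain Ω) :
    volume (frontier Ω) = 0 := by
  obtain ⟨H, hH, hcover⟩ := hΩ.frontier_flat
  refine measure_mono_null (t := ⋃ p ∈ H, {x : E d | inner ℝ p.1 x = p.2}) (fun x hx => ?_) ?_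
  · obtain ⟨p, hp, hpx⟩ := hcover x hx
    exact Set.mem_biUnion hp hpx
  · exact (measure_biUnion_null_iff H.countable_toSet).2 fun p hp =>
      volume_hyperplane (hH p hp) p.2

theorem convReact_nonneg (hΩ : IsPolytopalDomain Ω) (M : Mesh Ω) (K : Coefficients Ω)
    (v : WeakFn d) {T : Set (E d)} (hT : T ∈ M.elems) : 0 ≤ convReact M K v T := by
  have hTΩ : T ⊆ closure Ω := by
    rw [← M.cover]
    exact Set.subset_biUnion_of_mem (u := fun T : Set (E d) => T) hT
  have hTc := (M.isPolytope T hT).isCompact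
  refine add_nonneg (Finset.sum_nonneg fun e he => ?_) ?_
  · obtain ⟨he, heT⟩ := Finset.mem_filter.1 he
    have hec := (M.isFlatFace e he).isCompact
    have hcont : ContinuousOn (fun x => inner ℝ (K.b x) (outwardNormal T e)) e := by
      refine ContinuousOn.inner (𝕜 := ℝ) (K.isW1Infty.continuousOn.mono ?_) continuousOn_const
      exact (heT.trans hTc.isClosed.frontier_subset).trans hTΩ
    have hneg : MeasurableSet {x | x ∈ e ∧ inner ℝ (K.b x) (outwardNormal T e) < 0} := by
      have h1 := (hcont.preimage_isClosed_of_isClosed hec.isClosed (isClosed_Ici (a := 0))).measurableSet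
      convert hec.measurableSet.diff h1 using 1
      ext x
      simp only [Set.mem_ofPred_eq, Set.mem_sdiff, Set.mem_inter_iff, Set.mem_preimage,
        Set.mem_Ici, not_and, not_le]
      tauto
    have hpos : MeasurableSet {x | x ∈ e ∧ 0 < inner ℝ (K.b x) (outwardNormal T e)} := by
      have h1 := (hcont.preimage_isClosed_of_isClosed hec.isClosed (isClosed_Iic (a := 0))).measurableSet
      convert hec.measurableSet.diff h1 using 1
      ext x
      simp only [Set.mem_ofPred_eq, Set.mem_sdiff, Set.mem_inter_iff, Set.mem_preimage,
        Set.mem_Iic, not_and, not_le]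
      tauto
    refine add_nonneg (mul_nonneg (by norm_num) (setIntegral_nonneg hneg fun x hx => ?_))
      (mul_nonneg (by norm_num) (setIntegral_nonneg hpos fun x hx => ?_))
    · have h : inner ℝ (K.b x) (outwardNormal T e) * (pev (v.vb e) x - pev (v.v0 T) x) *
          (pev (v.v0 T) x - pev (v.vb e) x) =
          (-inner ℝ (K.b x) (outwardNormal T e)) * (pev (v.v0 T) x - pev (v.vb e) x) ^ 2 := by
        ring
      rw [h]
      exact mul_nonneg (neg_nonneg.2 hx.2.le) (sq_nonneg _)
    · rw [mul_assoc]
      exact mul_nonneg hx.2.le (mul_self_nonneg _)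
  · -- The coercivity bound holds almost everywhere on `T`, as `T` leaves `Ω` only in a null set.
    refine setIntegral_nonneg_of_ae_restrict ?_
    have h := K.coercive
    rw [ae_restrict_iff' hΩ.isOpen.measurableSet] at h
    rw [EventuallyLE, ae_restrict_iff' hTc.measurableSet]
    filter_upwards [h, compl_mem_ae_iff.2 hΩ.volume_frontier] with x hx hfr hxT
    have hxΩ : x ∈ Ω := by
      by_contra hcon
      refine hfr ?_
      rw [hΩ.isOpen.frontier_eq]
      exact ⟨hTΩ hxT, hcon⟩
    rw [mul_assoc]
    exact mul_nonneg (K.c₀_pos.le.trans (hx hxΩ)) (mul_self_nonneg _)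

end Convection

end WG

/-! ### Equivalence of the norms -/

theorem mainTheorem2 (d : ℕ) (hd : d = 2 ∨ d = 3) (k q : ℕ) (hq : q ≤ k)
    (ρ : ℝ) (hρ : 0 < ρ) (S : WG.ShapeConstants) :
    ∃ C₁ C₂ : ℝ, 0 < C₁ ∧ 0 < C₂ ∧
      ∀ (Ω : Set (WG.E d)), WG.IsPolytopalDomain Ω →
      ∀ (K : WG.Coefficients Ω) (M : WG.Mesh Ω), M.IsShapeRegular S →
      ∀ v ∈ M.Vh k q,
        C₁ * WG.norm1h M K ρ v ≤ WG.energyNorm M K ρ k v ∧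
        WG.energyNorm M K ρ k v ≤ C₂ * WG.norm1h M K ρ v := by
  obtain ⟨m, rfl⟩ : ∃ m, d = m + 1 := by
    rcases hd with rfl | rfl
    exacts [⟨1, rfl⟩, ⟨2, rfl⟩]
  obtain ⟨C, hC, hloc⟩ := WG.exists_local_equivalence m k q hq S
  -- The factors by which the squares of the two norms differ at most.
  let L : ℝ := 1 + C + ρ * C
  let U : ℝ := 1 + C + C / ρ
  have hL : 0 < L := by positivity
  have hU : 0 < U := by positivity
  refine ⟨(√U)⁻¹, √L, by positivity, by positivity, fun Ω hΩ K M hM v hv => ⟨?_, ?_⟩⟩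
  · rw [inv_mul_le_iff₀ (Real.sqrt_pos.2 hU), WG.norm1h, WG.energyNorm, ← Real.sqrt_mul hU.le]
    refine Real.sqrt_le_sqrt ?_
    rw [Finset.mul_sum]
    refine Finset.sum_le_sum fun T hT => ?_
    have h1 := (hloc Ω M hM v hv T hT).2
    have hc := WG.convReact_nonneg hΩ M K v hT
    have hB0 : 0 ≤ (Metric.diam T)⁻¹ * ∑ e ∈ M.facesOf T, ∫ x in e,
        (WG.pev (v.v0 T) x - WG.pev (v.vb e) x) ^ 2 ∂μHE[m + 1 - 1] :=
      mul_nonneg (inv_nonneg.2 Metric.diam_nonneg)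
        (Finset.sum_nonneg fun e _ => integral_nonneg fun x => sq_nonneg _)
    have hA0 : 0 ≤ ∫ x in T, ∑ i, WG.pev (MvPolynomial.pderiv i (v.v0 T)) x ^ 2 :=
      integral_nonneg fun x => Finset.sum_nonneg fun i _ => sq_nonneg _
    have hG0 : 0 ≤ ∫ x in T, ∑ i, WG.pev (M.weakGradient k v T i) x ^ 2 :=
      integral_nonneg fun x => Finset.sum_nonneg fun i _ => sq_nonneg _
    set B := (Metric.diam T)⁻¹ * ∑ e ∈ M.facesOf T, ∫ x in e,
        (WG.pev (v.v0 T) x - WG.pev (v.vb e) x) ^ 2 ∂μHE[m + 1 - 1]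
    set A := ∫ x in T, ∑ i, WG.pev (MvPolynomial.pderiv i (v.v0 T)) x ^ 2
    set G := ∫ x in T, ∑ i, WG.pev (M.weakGradient k v T i) x ^ 2
    set c := WG.convReact M K v T
    have hexp : U * (ρ * G + c) = ρ * G + C * (ρ * G) + C * G + (1 + C + C / ρ) * c := by
      simp only [U]
      field_simp
    have h2 : ρ * A ≤ ρ * (C * G) := by
      gcongr
      linarith
    have h3 : c ≤ (1 + C + C / ρ) * c := by
      refine le_mul_of_one_le_left hc ?_
      have : 0 ≤ C / ρ := by positivity
      linarith
    have h4 : 0 ≤ ρ * G := by positivity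
    rw [hexp]
    linarith
  · rw [WG.norm1h, WG.energyNorm, ← Real.sqrt_mul hL.le]
    refine Real.sqrt_le_sqrt ?_
    rw [Finset.mul_sum]
    refine Finset.sum_le_sum fun T hT => ?_
    have h1 := (hloc Ω M hM v hv T hT).1
    have hc := WG.convReact_nonneg hΩ M K v hT
    have hB0 : 0 ≤ (Metric.diam T)⁻¹ * ∑ e ∈ M.facesOf T, ∫ x in e,
        (WG.pev (v.v0 T) x - WG.pev (v.vb e) x) ^ 2 ∂μHE[m + 1 - 1] :=
      mul_nonneg (inv_nonneg.2 Metric.diam_nonneg)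
        (Finset.sum_nonneg fun e _ => integral_nonneg fun x => sq_nonneg _)
    have hA0 : 0 ≤ ∫ x in T, ∑ i, WG.pev (MvPolynomial.pderiv i (v.v0 T)) x ^ 2 :=
      integral_nonneg fun x => Finset.sum_nonneg fun i _ => sq_nonneg _
    set B := (Metric.diam T)⁻¹ * ∑ e ∈ M.facesOf T, ∫ x in e,
        (WG.pev (v.v0 T) x - WG.pev (v.vb e) x) ^ 2 ∂μHE[m + 1 - 1]
    set A := ∫ x in T, ∑ i, WG.pev (MvPolynomial.pderiv i (v.v0 T)) x ^ 2
    set G := ∫ x in T, ∑ i, WG.pev (M.weakGradient k v T i) x ^ 2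
    set c := WG.convReact M K v T
    have h2 : ρ * G ≤ ρ * (C * (A + B)) := by gcongr
    have hexp : L * (ρ * A + c + B) =
        ρ * (C * (A + B)) + c + (1 + ρ * C) * (ρ * A) + (C + ρ * C) * c + (1 + C) * B := by
      simp only [L]
      ring
    have h3 : 0 ≤ (1 + ρ * C) * (ρ * A) := by positivity
    have h4 : 0 ≤ (C + ρ * C) * c := by positivity
    have h5 : 0 ≤ (1 + C) * B := by positivity
    rw [hexp]
    linarith
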